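/- Let $d,n_1,\dots,n_d\in\mathbb{N}$. For each $r=1,\dots,d$ let $E_r\subset\mathbb{C}^{n_r}$ be a domain (open and connected), let $\Delta_r$ be an $s_r\times t_r$ matrix of holomorphic functions on $E_r$, and assume that $$B_{\Delta_r}:=\{z\in E_r : \|\Delta_r(z)\|<1\}$$ is connected and non-empty, where $\|\cdot\|$ is the operator norm between Euclidean spaces. For $z,w\in B_{\Delta_r}$ put $$d_{\Delta_r}(z,w):=\Big\|(I-\Delta_r(w)\Delta_r(w)^*)^{-\frac12}(\Delta_r(z)-\Delta_r(w))(I-\Delta_r(w)^*\Delta_r(z))^{-1}(I-\Delta_r(w)^*\Delta_r(w))^{\frac12}\Big\|$$ and let $$d_{B_{\Delta_r}}(z,w):=\sup_f\left|\frac{f(z)-f(w)}{1-\overline{f(w)}f(z)}\right|$$ be the Möbius pseudo-distance, the supremum being over all holomorphic functions $f$ from $B_{\Delta_r}$ to the open unit disk. Suppose that $d_{\Delta_r}=d_{B_{\Delta_r}}$ on $B_{\Delta_r}\times B_{\Delta_r}$ for each $r$. Then $$B_{\Delta_1}\times\cdots\times B_{\Delta_d}=B_{\Delta_1\oplus\cdots\oplus\Delta_d},$$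 where $(\Delta_1\oplus\cdots\oplus\Delta_d)(z_1,\dots,z_d)$ is the block diagonal matrix with blocks $\Delta_r(z_r)$ on $E_1\times\cdots\times E_d$, and this set is a complete spectral domain for every diagonalizable $(n_1+\cdots+n_d)$-tuple $T=(T^1,\dots,T^d)$ of operators on $\mathbb{C}^2$ such that $\sigma(T^r)\subset B_{\Delta_r}$ and $\|\Delta_r(T^r)\|\le 1$ for $r=1,\dots,d$. Here a tuple $T=(T_i)_i$ of operators on $\mathbb{C}^2$ is diagonalizable if there are linearly independent vectors $v_1,v_2\in\mathbb{C}^2$ and points $z_1,z_2$ (possibly equal) with $T_iv_j=(z_j)_iv_j$ for all $i,j$; such a tuple is commuting. Its joint spectrum $\sigma(T)$ is the set of its joint eigenvalues, that is $\{z_1,z_2\}$. For a matrix-valued function $F$ on $\sigma(T)$ with values in $B(\mathbb{C}^l,\mathbb{C}^m)$, $F(T)\in B(\mathbb{C}^l\otimes\mathbb{C}^2,\mathbb{C}^m\otimes\mathbb{C}^2)$ is the unique operator with $F(T)(x\otimes v_j)=F(z_j)x\otimes v_j$ for all $x\in\mathbb{C}^l$ and $j=1,2$. A domain $\Omega$ is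 a complete spectral domain for $T$ if $\sigma(T)\subset\Omega$ and, for every positive integer $k$ and every holomorphic $k\times k$-matrix-valued function $f$ on $\Omega$, $$\|f(T)\|\le\sup_{z\in\Omega}\|f(z)\|\in[0,\infty].$$ -/

import Mathlib

open scoped Matrix ENNReal MatrixOrder

-- Throughout, matrices carry the operator norm with respect to Euclidean norms.
open scoped Matrix.Norms.L2Operator

/-- The set `B_Δ` of all points `z` of `E` with `‖Δ(z)‖ < 1` (operator norm),
for a matrix-valued function `Δ` on a set `E` of points of `ℂ^ι`. -/
def matrixBall {ι m l : Type*} [Fintype m] [Fintype l] [DecidableEq l]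
    (E : Set (ι → ℂ)) (Δ : (ι → ℂ) → Matrix m l ℂ) : Set (ι → ℂ) :=
  {z | z ∈ E ∧ ‖Δ z‖ < 1}

/-- `Δ` is a matrix of holomorphic functions on `E`. -/
def IsHolomorphicMatrixOn {ι m l : Type*} [Fintype ι]
    (Δ : (ι → ℂ) → Matrix m l ℂ) (E : Set (ι → ℂ)) : Prop :=
  ∀ i j, DifferentiableOn ℂ (fun z => Δ z i j) E

/-- The pseudo-hyperbolic distance of the open unit disk. -/
noncomputable def pseudoHyperbolicDist (z w : ℂ) : ℝ :=
  ‖(z - w) / (1 - (starRingEnd ℂ) w * z)‖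

/-- The Moebius pseudo-distance `d_Ω`: the supremum of the pseudo-hyperbolic distances of
`f z` and `f w` over all holomorphic functions `f` from `Ω` to the open unit disk. -/
noncomputable def moebiusDist {ι : Type*} [Fintype ι] (Ω : Set (ι → ℂ)) (z w : ι → ℂ) : ℝ :=
  sSup {x : ℝ | ∃ f : (ι → ℂ) → ℂ, DifferentiableOn ℂ f Ω ∧ (∀ ζ ∈ Ω, ‖f ζ‖ < 1) ∧
    x = pseudoHyperbolicDist (f z) (f w)}

/-- The pseudo-distance `d_Δ`, the norm of
`(I - Δ(w)Δ(w)*)^(-1/2) (Δ(z) - Δ(w)) (I - Δ(w)*Δ(z))^(-1) (I - Δ(w)*Δ(w))^(1/2)`. -/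
noncomputable def matrixDist {ι m l : Type*} [Fintype m] [Fintype l] [DecidableEq m]
    [DecidableEq l] (Δ : (ι → ℂ) → Matrix m l ℂ) (z w : ι → ℂ) : ℝ :=
  ‖(CFC.sqrt (1 - Δ w * (Δ w)ᴴ))⁻¹ * (Δ z - Δ w) * (1 - (Δ w)ᴴ * Δ z)⁻¹ *
    CFC.sqrt (1 - (Δ w)ᴴ * Δ w)‖

/-- `v` is a vector with `T i v = (a i) v` for all `i`. -/
def IsJointEigenpair {ι : Type*} (T : ι → Matrix (Fin 2) (Fin 2) ℂ) (a : ι → ℂ)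
    (v : Fin 2 → ℂ) : Prop :=
  ∀ i, T i *ᵥ v = a i • v

/-- The joint spectrum `σ(T)` of a commuting tuple of operators on `ℂ²`: the set of its joint
eigenvalues. -/
def jointSpectrum {ι : Type*} (T : ι → Matrix (Fin 2) (Fin 2) ℂ) : Set (ι → ℂ) :=
  {a | ∃ v : Fin 2 → ℂ, v ≠ 0 ∧ IsJointEigenpair T a v}

/-- The tuple `T` has two linearly independent joint eigenvectors, with joint eigenvalues that
may coincide. Such a tuple is automatically commuting. -/
def IsDiagonalizableTuple {ι : Type*} (T : ι → Matrix (Fin 2) (Fin 2) ℂ) : Prop :=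
  ∃ (v : Fin 2 → Fin 2 → ℂ) (z : Fin 2 → ι → ℂ),
    LinearIndependent ℂ v ∧ ∀ j, IsJointEigenpair T (z j) (v j)

/-- The elementary tensor `x ⊗ v`. -/
def tensorVec {l : Type*} (x : l → ℂ) (v : Fin 2 → ℂ) : l × Fin 2 → ℂ :=
  fun p => x p.1 * v p.2

/-- `M` is the operator `F(T) : ℂ^l ⊗ ℂ² → ℂ^m ⊗ ℂ²`, that is, it maps `x ⊗ v` to `F(a) x ⊗ v`
for every joint eigenvector `v` of `T` with joint eigenvalue `a`. -/
def IsTupleValue {ι m l : Type*} [Fintype l] (F : (ι → ℂ) → Matrix m l ℂ)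
    (T : ι → Matrix (Fin 2) (Fin 2) ℂ) (M : Matrix (m × Fin 2) (l × Fin 2) ℂ) : Prop :=
  ∀ (a : ι → ℂ) (v : Fin 2 → ℂ), v ≠ 0 → IsJointEigenpair T a v →
    ∀ x : l → ℂ, M *ᵥ tensorVec x v = tensorVec (F a *ᵥ x) v

/-- For a diagonalizable tuple `T` there is exactly one operator `F(T)`. -/
theorem IsDiagonalizableTuple.existsUnique_isTupleValue {ι m l : Type*} [Fintype l]
    {T : ι → Matrix (Fin 2) (Fin 2) ℂ} (hT : IsDiagonalizableTuple T)
    (F : (ι → ℂ) → Matrix m l ℂ) :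
    ∃! M : Matrix (m × Fin 2) (l × Fin 2) ℂ, IsTupleValue F T M := by
  classical
  obtain ⟨v, z, hv, hz⟩ := hT
  let b := basisOfLinearIndependentOfCardEqFinrank hv (by simp)
  have hb : ∀ j, b j = v j := fun j => by simp [b]
  have key : ∀ (M : Matrix (m × Fin 2) (l × Fin 2) ℂ) (x : l → ℂ) (c : Fin 2 → ℂ)
      (y : Fin 2 → Fin 2 → ℂ),
      M *ᵥ tensorVec x (∑ j, c j • y j) = ∑ j, c j • (M *ᵥ tensorVec x (y j)) := by
    intro M x c y
    simp only [← Matrix.mulVec_smul, ← Matrix.mulVec_sum]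
    congr 1
    ext p
    simp [tensorVec]
    ring
  have hex : IsTupleValue F T (Matrix.of fun p q =>
      ∑ j, F (z j) p.1 q.1 * (v j p.2 * b.repr (Pi.single q.2 1) j)) := by
    intro a u _ hu x
    have hcoord : ∀ j, ∑ k, b.repr (Pi.single k 1) j * u k = b.repr u j := by
      intro j
      have h1 : u = ∑ k, u k • (Pi.single k 1 : Fin 2 → ℂ) := by
        ext t; simp [Finset.sum_apply, Pi.single_apply]
      conv_rhs => rw [h1]
      simp [mul_comm]
    have hu' : u = ∑ j, b.repr u j • v j := by
      conv_lhs => rw [← b.sum_repr u]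
      simp [hb]
    have hz' : ∀ j, b.repr u j ≠ 0 → z j = a := by
      intro j hj
      ext i
      have h1 : ∑ k, (b.repr u k * (z k i - a i)) • v k = 0 := by
        have h2 := hu i
        rw [hu', Matrix.mulVec_sum, Finset.smul_sum, ← sub_eq_zero,
          ← Finset.sum_sub_distrib] at h2
        rw [← h2]
        refine Finset.sum_congr rfl fun k _ => ?_
        rw [Matrix.mulVec_smul, hz k i, smul_smul, smul_smul, ← sub_smul]
        congr 1
        ring
      have h3 := Fintype.linearIndependent_iff.1 hv _ h1 j
      exact sub_eq_zero.1 ((mul_eq_zero.1 h3).resolve_left hj)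
    have hE : ∀ (p : m) j, b.repr u j * (F (z j) *ᵥ x) p = b.repr u j * (F a *ᵥ x) p := by
      intro p j
      by_cases h : b.repr u j = 0
      · simp [h]
      · rw [hz' j h]
    ext p
    have h1 : tensorVec (F a *ᵥ x) u p = ∑ j, b.repr u j * (F a *ᵥ x) p.1 * v j p.2 := by
      have : u p.2 = ∑ j, b.repr u j * v j p.2 := by
        conv_lhs => rw [hu']
        simp
      simp only [tensorVec]
      rw [this, Finset.mul_sum]
      exact Finset.sum_congr rfl fun j _ => by ring
    rw [h1]
    simp_rw [← hE, ← hcoord]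
    simp only [Matrix.mulVec, dotProduct, Fintype.sum_prod_type, Matrix.of_apply, tensorVec,
      Fin.sum_univ_two, Finset.mul_sum, Finset.sum_mul, ← Finset.sum_add_distrib]
    exact Finset.sum_congr rfl fun j _ => by ring
  refine ⟨_, hex, ?_⟩
  · intro M' hM'
    have hval : ∀ M : Matrix (m × Fin 2) (l × Fin 2) ℂ, IsTupleValue F T M →
        ∀ (p : m × Fin 2) (q : l × Fin 2), M p q = (∑ j, b.repr (Pi.single q.2 1) j •
          tensorVec (F (z j) *ᵥ Pi.single q.1 1) (v j)) p := by
      intro M hM p q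
      have h1 : (Pi.single q.2 1 : Fin 2 → ℂ) = ∑ j, b.repr (Pi.single q.2 1) j • v j := by
        conv_lhs => rw [← b.sum_repr (Pi.single q.2 1)]
        simp [hb]
      have h2 := key M (Pi.single q.1 1) (fun j => b.repr (Pi.single q.2 1) j) v
      rw [← h1] at h2
      have h3 : tensorVec (Pi.single q.1 1 : l → ℂ) (Pi.single q.2 1) = Pi.single q 1 := by
        ext t
        rcases t with ⟨t1, t2⟩
        rcases q with ⟨q1, q2⟩
        simp only [tensorVec, Pi.single_apply, Prod.mk.injEq]
        by_cases h : t1 = q1 <;> by_cases h' : t2 = q2 <;> simp [h, h']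
      rw [h3] at h2
      have h4 := congrFun h2 p
      rw [Matrix.mulVec_single_one] at h4
      simp only [Matrix.col_apply] at h4
      simp_rw [h4, hM _ _ (hv.ne_zero _) (hz _)]
    ext p q
    rw [hval M' hM', hval _ hex]

open Classical in
/-- The operator `F(T) : ℂ^l ⊗ ℂ² → ℂ^m ⊗ ℂ²` for a diagonalizable tuple `T`
(the value is `0` if no such operator exists). -/
noncomputable def tupleEval {ι m l : Type*} [Fintype l] (F : (ι → ℂ) → Matrix m l ℂ)
    (T : ι → Matrix (Fin 2) (Fin 2) ℂ) : Matrix (m × Fin 2) (l × Fin 2) ℂ :=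
  if h : ∃ M, IsTupleValue F T M then h.choose else 0

theorem IsDiagonalizableTuple.isTupleValue_tupleEval {ι m l : Type*} [Fintype l]
    {T : ι → Matrix (Fin 2) (Fin 2) ℂ} (hT : IsDiagonalizableTuple T)
    (F : (ι → ℂ) → Matrix m l ℂ) : IsTupleValue F T (tupleEval F T) := by
  have h := (hT.existsUnique_isTupleValue F).exists
  rw [tupleEval, dif_pos h]
  exact h.choose_spec

/-- The open connected set `Ω` is a complete spectral domain for the diagonalizable tuple `T`:
it contains `σ(T)`, and `‖f(T)‖` is at most the supremum (in `[0, ∞]`) of `‖f(z)‖` over `Ω`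
for every holomorphic square-matrix-valued function `f` on `Ω`. -/
def IsCompleteSpectralDomain {ι : Type*} [Fintype ι] (Ω : Set (ι → ℂ))
    (T : ι → Matrix (Fin 2) (Fin 2) ℂ) : Prop :=
  IsOpen Ω ∧ IsConnected Ω ∧ jointSpectrum T ⊆ Ω ∧
    ∀ k : ℕ, 0 < k → ∀ f : (ι → ℂ) → Matrix (Fin k) (Fin k) ℂ, IsHolomorphicMatrixOn f Ω →
      ‖tupleEval f T‖ₑ ≤ ⨆ z ∈ Ω, ‖f z‖ₑ

/-- The `r`-th block of an `(n 0 + ... + n (d-1))`-tuple. -/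
def tupleBlock {d : ℕ} {n : Fin d → ℕ} {α : Type*} (x : (Σ r, Fin (n r)) → α) (r : Fin d) :
    Fin (n r) → α :=
  fun i => x ⟨r, i⟩

/-- The blocks of a diagonalizable tuple are diagonalizable. -/
theorem IsDiagonalizableTuple.tupleBlock {d : ℕ} {n : Fin d → ℕ}
    {T : (Σ r, Fin (n r)) → Matrix (Fin 2) (Fin 2) ℂ} (hT : IsDiagonalizableTuple T)
    (r : Fin d) : IsDiagonalizableTuple (tupleBlock T r) := by
  obtain ⟨v, z, hv, hz⟩ := hT
  exact ⟨v, fun j i => z j ⟨r, i⟩, hv, fun j i => hz j ⟨r, i⟩⟩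

/-- The product of the sets `A r`. -/
def blockProd {d : ℕ} {n : Fin d → ℕ} (A : ∀ r, Set (Fin (n r) → ℂ)) :
    Set ((Σ r, Fin (n r)) → ℂ) :=
  {z | ∀ r, tupleBlock z r ∈ A r}

/-- The block diagonal matrix function with blocks `Δ r (z r)`. -/
def matrixDirectSum {d : ℕ} {n s t : Fin d → ℕ}
    (Δ : ∀ r, (Fin (n r) → ℂ) → Matrix (Fin (s r)) (Fin (t r)) ℂ)
    (z : (Σ r, Fin (n r)) → ℂ) : Matrix (Σ r, Fin (s r)) (Σ r, Fin (t r)) ℂ :=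
  Matrix.blockDiagonal' fun r => Δ r (tupleBlock z r)

/-! Let `v 0`, `v 1` be joint eigenvectors at `z 0`, `z 1`, and let `θ` be the angle between them.
The proof turns operator inequalities for `T` into a distance inequality between the two
eigenvalues.

If `F` takes strictly contractive values at both points, then `1 - F(T)* F(T)`, written in the
columns `e i ⊗ v j`, is a 2 × 2 block matrix, and its Schur complement shows that `‖F(T)‖ ≤ 1` iff
the matrix Möbius transform of the pair `F (z 0)`, `F (z 1)` has norm at most `sin θ = √(1 - cosSq
v)` (`norm_le_one_iff_norm_matrixMoebius_le`). For `F = Δ r` that norm is `matrixDist`, hence by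
hypothesis `moebiusDist`, so each factor has its two points within Möbius distance `sin θ`.

The Möbius pseudo-distance of a product is at most the maximum of those of the factors
(`moebiusDist_blockProd_le`), so `z 0` and `z 1` are within `sin θ` in the product domain. A matrix
Schwarz–Pick lemma (`norm_matrixMoebius_le_moebiusDist`) carries this bound to every holomorphic `f`
into the open matrix ball, and the equivalence is read backwards for `f`.

The product property is the analytic core. Suppose `g : X → 𝔻` satisfies `g p = 0`, `g q = s`, with
`s` below the distance of `p'`, `q'` in `Y`. Interpolate the evaluations at `p'` and `q'` by a
holomorphic family of functionals `φ l` on bounded holomorphic functions on `Y`, with `φ 0`, `φ s`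
the two evaluations and norms at most `r⁻¹`. Then `x ↦ r * φ (g x) (f (x, ·))` maps `X` into the
closed disk, and the bound on `X` applies to it. The family comes from Hahn–Banach for an `L¹`
seminorm on the circle (`exists_holomorphic_family_of_bound`); the estimate required there
(`norm_polyValue_sub_le`) is proved by dividing by an outer function. -/

section MatrixMoebius

open scoped ComplexConjugate ComplexOrder

/-! ### Matrix Möbius transformations -/

section

variable {m l : Type*} [Fintype m] [Fintype l] [DecidableEq l]

theorem norm_le_iff_posSemidef (M : Matrix m l ℂ) {c : ℝ} (hc : 0 ≤ c) :
    ‖M‖ ≤ c ↔ ((c ^ 2) • (1 : Matrix l l ℂ) - Mᴴ * M).PosSemidef := by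
  rw [← Matrix.le_iff, ← Algebra.algebraMap_eq_smul_one,
    ← CStarAlgebra.norm_le_iff_le_algebraMap _ (sq_nonneg c)
      (Matrix.nonneg_iff_posSemidef.2 (Matrix.posSemidef_conjTranspose_mul_self M)),
    Matrix.l2_opNorm_conjTranspose_mul_self, ← sq, sq_le_sq₀ (norm_nonneg _) hc]

theorem posDef_one_sub {M : Matrix m l ℂ} (hM : ‖M‖ < 1) : (1 - Mᴴ * M).PosDef := by
  have h1 := (norm_le_iff_posSemidef M (norm_nonneg M)).1 le_rfl
  have h2 : ((1 - ‖M‖ ^ 2) • (1 : Matrix l l ℂ)).PosDef :=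
    Matrix.PosDef.one.smul (by nlinarith [norm_nonneg M])
  have h3 := h2.add_posSemidef h1
  convert! h3 using 1
  rw [sub_smul, one_smul]
  abel

variable [DecidableEq m]

theorem posDef_one_sub' {M : Matrix m l ℂ} (hM : ‖M‖ < 1) : (1 - M * Mᴴ).PosDef := by
  have h := posDef_one_sub (M := Mᴴ) (by rwa [Matrix.l2_opNorm_conjTranspose])
  rwa [Matrix.conjTranspose_conjTranspose] at h

theorem sqrt_facts {P : Matrix l l ℂ} (hP : P.PosDef) :
    CFC.sqrt P * CFC.sqrt P = P ∧ (CFC.sqrt P)ᴴ = CFC.sqrt P ∧ IsUnit (CFC.sqrt P) := by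
  have h0 : 0 ≤ P := Matrix.nonneg_iff_posSemidef.2 hP.posSemidef
  have h1 := CFC.sqrt_mul_sqrt_self P h0
  refine ⟨h1, (Matrix.nonneg_iff_posSemidef.1 (CFC.sqrt_nonneg P)).isHermitian, ?_⟩
  have h2 : IsUnit (CFC.sqrt P * CFC.sqrt P) := by rw [h1]; exact hP.isUnit
  exact isUnit_of_mul_isUnit_left h2

theorem isUnit_one_sub_conjTranspose_mul {A B : Matrix m l ℂ} (hA : ‖A‖ < 1) (hB : ‖B‖ < 1) :
    IsUnit (1 - Aᴴ * B) := by
  refine isUnit_one_sub_of_norm_lt_one ?_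
  refine (Matrix.l2_opNorm_mul _ _).trans_lt ?_
  rw [Matrix.l2_opNorm_conjTranspose]
  nlinarith [norm_nonneg A, norm_nonneg B]

/-- The matrix Möbius transformation that maps `A` to zero, evaluated at `B`. -/
noncomputable def matrixMoebius (A B : Matrix m l ℂ) : Matrix m l ℂ :=
  (CFC.sqrt (1 - A * Aᴴ))⁻¹ * (B - A) * (1 - Aᴴ * B)⁻¹ * CFC.sqrt (1 - Aᴴ * A)

theorem matrixMoebius_self (A : Matrix m l ℂ) : matrixMoebius A A = 0 := by
  simp [matrixMoebius]

/-- The Woodbury identity; it leaves a single inverse in the computation of the defect. -/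
theorem inv_one_sub_mul_conjTranspose {A : Matrix m l ℂ} (hA : ‖A‖ < 1) :
    (1 - A * Aᴴ)⁻¹ = 1 + A * (1 - Aᴴ * A)⁻¹ * Aᴴ := by
  apply Matrix.inv_eq_right_inv
  have hP := (posDef_one_sub hA).isUnit
  have h1 : Aᴴ * A * (1 - Aᴴ * A)⁻¹ = (1 - Aᴴ * A)⁻¹ - 1 := by
    have h := Matrix.mul_nonsing_inv _ ((Matrix.isUnit_iff_isUnit_det _).1 hP)
    rw [Matrix.sub_mul, Matrix.one_mul] at h
    rw [sub_eq_iff_eq_add'] at h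
    exact eq_sub_of_add_eq h.symm
  generalize (1 - Aᴴ * A)⁻¹ = G at h1
  have h2 : A * Aᴴ * (A * G * Aᴴ) = A * (Aᴴ * A * G) * Aᴴ := by simp only [Matrix.mul_assoc]
  rw [Matrix.mul_add, Matrix.mul_one, Matrix.sub_mul, Matrix.one_mul, h2, h1, Matrix.mul_sub,
    Matrix.sub_mul, Matrix.mul_one]
  abel

/-- The matrix form of `|1 - āb|² - |b - a|² = (1 - |a|²)(1 - |b|²)`. Expanding in `D = B - A`, all
inverses cancel against `1 - Aᴴ * A` except in a term quadratic in `D`, which the Woodbury identity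
cancels. -/
theorem defect_identity {A B : Matrix m l ℂ} (hA : ‖A‖ < 1) :
    (1 - Aᴴ * B)ᴴ * (1 - Aᴴ * A)⁻¹ * (1 - Aᴴ * B) - (B - A)ᴴ * (1 - A * Aᴴ)⁻¹ * (B - A) =
      1 - Bᴴ * B := by
  have hP := (Matrix.isUnit_iff_isUnit_det _).1 (posDef_one_sub hA).isUnit
  rw [inv_one_sub_mul_conjTranspose hA]
  have h1 := Matrix.mul_nonsing_inv _ hP
  have h2 := Matrix.nonsing_inv_mul _ hP
  have hherm : (1 - Aᴴ * A)ᴴ = 1 - Aᴴ * A := (posDef_one_sub hA).isHermitian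
  obtain ⟨D, rfl⟩ : ∃ D, B = A + D := ⟨B - A, by abel⟩
  have hR : 1 - Aᴴ * (A + D) = (1 - Aᴴ * A) - Aᴴ * D := by
    rw [Matrix.mul_add]; abel
  rw [hR, Matrix.conjTranspose_sub, hherm, add_sub_cancel_left, Matrix.conjTranspose_mul,
    Matrix.conjTranspose_conjTranspose]
  have e1 : ((1 - Aᴴ * A) - Dᴴ * A) * (1 - Aᴴ * A)⁻¹ * ((1 - Aᴴ * A) - Aᴴ * D) =
      (1 - Aᴴ * A) - Aᴴ * D - Dᴴ * A + Dᴴ * (A * (1 - Aᴴ * A)⁻¹ * Aᴴ) * D := by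
    rw [Matrix.sub_mul, h1, Matrix.sub_mul, Matrix.one_mul, Matrix.mul_sub,
      Matrix.mul_assoc (Dᴴ * A), h2, Matrix.mul_one]
    simp only [Matrix.mul_assoc]
    abel
  rw [e1, Matrix.mul_add, Matrix.add_mul, Matrix.mul_one, Matrix.conjTranspose_add, Matrix.add_mul,
    Matrix.mul_add, Matrix.mul_add]
  abel

/-- Conjugating `s² - m* m`, for `m` the Möbius transform, by `(1 - Aᴴ A)^(-1/2) (1 - Aᴴ B)` removes
both square roots, and the defect identity rewrites what remains. This form is the one a Schur
complement produces. -/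
theorem norm_matrixMoebius_le_iff {A B : Matrix m l ℂ} (hA : ‖A‖ < 1) (hB : ‖B‖ < 1) {s : ℝ}
    (hs : 0 ≤ s) :
    ‖matrixMoebius A B‖ ≤ s ↔ ((1 - Bᴴ * B) -
      (1 - s ^ 2) • ((1 - Aᴴ * B)ᴴ * (1 - Aᴴ * A)⁻¹ * (1 - Aᴴ * B))).PosSemidef := by
  obtain ⟨hS, hSh, hSu⟩ := sqrt_facts (posDef_one_sub hA)
  obtain ⟨hS', hSh', hSu'⟩ := sqrt_facts (posDef_one_sub' hA)
  have hR := isUnit_one_sub_conjTranspose_mul hA hB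
  have hid := defect_identity (B := B) hA
  rw [norm_le_iff_posSemidef _ hs]
  have hSd := (Matrix.isUnit_iff_isUnit_det _).1 hSu
  have hRd := (Matrix.isUnit_iff_isUnit_det _).1 hR
  have hU : IsUnit ((CFC.sqrt (1 - Aᴴ * A))⁻¹ * (1 - Aᴴ * B)) :=
    ((Matrix.isUnit_nonsing_inv_iff).2 hSu).mul hR
  rw [← Matrix.IsUnit.posSemidef_star_left_conjugate_iff hU]
  unfold matrixMoebius
  set S := CFC.sqrt (1 - Aᴴ * A)
  set S' := CFC.sqrt (1 - A * Aᴴ)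
  set R := 1 - Aᴴ * B
  have e1 : S'⁻¹ * (B - A) * R⁻¹ * S * (S⁻¹ * R) = S'⁻¹ * (B - A) := by
    rw [Matrix.mul_assoc _ S, ← Matrix.mul_assoc S, Matrix.mul_nonsing_inv _ hSd, Matrix.one_mul,
      Matrix.mul_assoc _ R⁻¹, Matrix.nonsing_inv_mul _ hRd, Matrix.mul_one]
  have e2 : star (S⁻¹ * R) * (S⁻¹ * R) = Rᴴ * (1 - Aᴴ * A)⁻¹ * R := by
    rw [Matrix.star_eq_conjTranspose, Matrix.conjTranspose_mul, Matrix.conjTranspose_nonsing_inv,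
      hSh, ← hS, Matrix.mul_inv_rev]
    simp only [Matrix.mul_assoc]
  have e3 : (S'⁻¹ * (B - A))ᴴ * (S'⁻¹ * (B - A)) = (B - A)ᴴ * (1 - A * Aᴴ)⁻¹ * (B - A) := by
    rw [Matrix.conjTranspose_mul, Matrix.conjTranspose_nonsing_inv,
      hSh', ← hS', Matrix.mul_inv_rev]
    simp only [Matrix.mul_assoc]
  have e4 : star (S⁻¹ * R) * ((s ^ 2) • 1 -
      (S'⁻¹ * (B - A) * R⁻¹ * S)ᴴ * (S'⁻¹ * (B - A) * R⁻¹ * S)) * (S⁻¹ * R) =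
      (1 - Bᴴ * B) - (1 - s ^ 2) • (Rᴴ * (1 - Aᴴ * A)⁻¹ * R) := by
    have e5 : star (S⁻¹ * R) * ((S'⁻¹ * (B - A) * R⁻¹ * S)ᴴ * (S'⁻¹ * (B - A) * R⁻¹ * S)) *
        (S⁻¹ * R) = (S'⁻¹ * (B - A))ᴴ * (S'⁻¹ * (B - A)) := by
      conv_rhs => rw [← e1]
      rw [Matrix.conjTranspose_mul (S'⁻¹ * (B - A) * R⁻¹ * S), Matrix.star_eq_conjTranspose]
      simp only [Matrix.mul_assoc]
    rw [Matrix.mul_sub, Matrix.sub_mul, e5, e3, Matrix.mul_smul, Matrix.smul_mul, Matrix.mul_one,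
      e2, sub_smul, one_smul, ← hid]
    abel
  rw [e4]

theorem norm_matrixMoebius_le_one {A B : Matrix m l ℂ} (hA : ‖A‖ < 1) (hB : ‖B‖ < 1) :
    ‖matrixMoebius A B‖ ≤ 1 := by
  rw [norm_matrixMoebius_le_iff hA hB zero_le_one]
  simpa using (posDef_one_sub hB).posSemidef

end

/-! ### Contractivity of an operator with two tensor eigenspaces -/

section

variable {m l : Type*} [Fintype m] [Fintype l] [DecidableEq m] [DecidableEq l]

/-- The matrix with the columns `e i ⊗ v 0` and `e i ⊗ v 1`. -/
def tensorCols (l : Type*) [DecidableEq l] (v : Fin 2 → Fin 2 → ℂ) :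
    Matrix (l × Fin 2) (l ⊕ l) ℂ :=
  Matrix.of fun p => Sum.elim (fun i => if p.1 = i then v 0 p.2 else 0)
    (fun i => if p.1 = i then v 1 p.2 else 0)

theorem tensorCols_mulVec (v : Fin 2 → Fin 2 → ℂ) (x : l ⊕ l → ℂ) :
    tensorCols l v *ᵥ x =
      tensorVec (fun i => x (.inl i)) (v 0) + tensorVec (fun i => x (.inr i)) (v 1) := by
  ext p
  simp [tensorCols, Matrix.mulVec, dotProduct, Fintype.sum_sum_type, tensorVec, mul_comm]

/-- A right inverse is enough to undo the congruence by `tensorCols l v`, so positivity transfers in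
both directions. -/
theorem exists_tensorCols_mul_eq_one {v : Fin 2 → Fin 2 → ℂ} (hv : LinearIndependent ℂ v) :
    ∃ W : Matrix (l ⊕ l) (l × Fin 2) ℂ, tensorCols l v * W = 1 := by
  have hu : IsUnit (Matrix.of v) := Matrix.linearIndependent_rows_iff_isUnit.1 hv
  have h1 := Matrix.nonsing_inv_mul _ ((Matrix.isUnit_iff_isUnit_det _).1 hu)
  refine ⟨Matrix.of fun q p => Sum.elim
    (fun i => if i = p.1 then (Matrix.of v)⁻¹ p.2 0 else 0)
    (fun i => if i = p.1 then (Matrix.of v)⁻¹ p.2 1 else 0) q, ?_⟩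
  ext ⟨i, k⟩ ⟨i', k'⟩
  have h2 := congrFun (congrFun h1 k') k
  rw [Matrix.mul_apply, Fin.sum_univ_two] at h2
  change _ * v 0 k + _ * v 1 k = _ at h2
  rw [Matrix.mul_apply, Fintype.sum_sum_type]
  change ∑ x, (if i = x then v 0 k else 0) * (if x = i' then (Matrix.of v)⁻¹ k' 0 else 0) +
    ∑ x, (if i = x then v 1 k else 0) * (if x = i' then (Matrix.of v)⁻¹ k' 1 else 0) = _
  rw [Finset.sum_eq_single i (fun x _ hx => by simp [hx.symm]) (by simp),
    Finset.sum_eq_single i (fun x _ hx => by simp [hx.symm]) (by simp)]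
  by_cases h : i = i'
  · subst h
    simp only [if_true]
    rw [mul_comm (v 0 k), mul_comm (v 1 k), h2]
    simp [Matrix.one_apply, eq_comm]
  · simp [h]

theorem sum_tensor_gram (a b : Fin 2 → ℂ) (p q : l) :
    ∑ x : l × Fin 2, star (if x.1 = p then a x.2 else 0) * (if x.1 = q then b x.2 else 0) =
      ((star a ⬝ᵥ b) • (1 : Matrix l l ℂ)) p q := by
  rw [Fintype.sum_prod_type, Finset.sum_eq_single p (fun x _ hx => by simp [hx]) (by simp)]
  by_cases h : p = q
  · subst h; simp [dotProduct]
  · simp [h]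

theorem tensorCols_gram (v : Fin 2 → Fin 2 → ℂ) :
    (tensorCols l v)ᴴ * tensorCols l v = Matrix.fromBlocks
      ((star (v 0) ⬝ᵥ v 0) • 1) ((star (v 0) ⬝ᵥ v 1) • 1)
      ((star (v 1) ⬝ᵥ v 0) • 1) ((star (v 1) ⬝ᵥ v 1) • 1) := by
  ext p q
  rcases p with p | p <;> rcases q with q | q <;> exact sum_tensor_gram _ _ _ _

theorem mul_tensorCols {A B : Matrix m l ℂ} {v : Fin 2 → Fin 2 → ℂ}
    {M : Matrix (m × Fin 2) (l × Fin 2) ℂ}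
    (hA : ∀ x, M *ᵥ tensorVec x (v 0) = tensorVec (A *ᵥ x) (v 0))
    (hB : ∀ x, M *ᵥ tensorVec x (v 1) = tensorVec (B *ᵥ x) (v 1)) :
    M * tensorCols l v = tensorCols m v * Matrix.fromBlocks A 0 0 B := by
  refine Matrix.ext_of_mulVec_single fun q => ?_
  rw [← Matrix.mulVec_mulVec, ← Matrix.mulVec_mulVec, tensorCols_mulVec, tensorCols_mulVec,
    Matrix.mulVec_add, hA, hB, Matrix.fromBlocks_mulVec]
  congr 2
  · ext i; simp [Function.comp_def]
  · ext i; simp [Function.comp_def]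

/-- The squared cosine of the angle between two vectors. -/
noncomputable def cosSq (v : Fin 2 → Fin 2 → ℂ) : ℝ :=
  ‖star (v 0) ⬝ᵥ v 1‖ ^ 2 / ((∑ k, ‖v 0 k‖ ^ 2) * ∑ k, ‖v 1 k‖ ^ 2)

theorem star_dotProduct_self (x : Fin 2 → ℂ) : star x ⬝ᵥ x = ((∑ k, ‖x k‖ ^ 2 : ℝ) : ℂ) := by
  simp [dotProduct, Complex.conj_mul']

theorem sum_norm_sq_pos {x : Fin 2 → ℂ} (hx : x ≠ 0) : 0 < ∑ k, ‖x k‖ ^ 2 := by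
  obtain ⟨k, hk⟩ := Function.ne_iff.1 hx
  exact Finset.sum_pos' (fun _ _ => by positivity) ⟨k, Finset.mem_univ _, by
    have : 0 < ‖x k‖ := norm_pos_iff.2 hk
    positivity⟩

theorem cosSq_le_one (v : Fin 2 → Fin 2 → ℂ) : cosSq v ≤ 1 := by
  refine div_le_one_of_le₀ ?_ (by positivity)
  have h := norm_inner_le_norm (𝕜 := ℂ) (WithLp.toLp 2 (v 0)) (WithLp.toLp 2 (v 1))
  have e : inner ℂ (WithLp.toLp 2 (v 0)) (WithLp.toLp 2 (v 1)) = star (v 0) ⬝ᵥ v 1 := by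
    rw [EuclideanSpace.inner_toLp_toLp, dotProduct_comm]
  rw [e] at h
  calc _ ≤ (‖WithLp.toLp 2 (v 0)‖ * ‖WithLp.toLp 2 (v 1)‖) ^ 2 := by gcongr
    _ = _ := by rw [mul_pow, EuclideanSpace.norm_sq_eq, EuclideanSpace.norm_sq_eq]

theorem posSemidef_smul_iff {κ : Type*} {X : Matrix κ κ ℂ} {c : ℝ} (hc : 0 < c) :
    (c • X).PosSemidef ↔ X.PosSemidef := by
  refine ⟨fun h => ?_, fun h => h.smul hc.le⟩
  have := h.smul (inv_nonneg.2 hc.le)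
  rwa [smul_smul, inv_mul_cancel₀ hc.ne', one_smul] at this

/-- Congruence by the columns `e i ⊗ v j` turns `1 - Mᴴ * M` into blocks weighted by the Gram matrix
of `v`. The Schur complement of the first block is a positive multiple of the criterion of
`norm_matrixMoebius_le_iff` with `1 - s ^ 2 = cosSq v`. -/
theorem norm_le_one_iff_norm_matrixMoebius_le {A B : Matrix m l ℂ} (hA : ‖A‖ < 1) (hB : ‖B‖ < 1)
    {v : Fin 2 → Fin 2 → ℂ} (hv : LinearIndependent ℂ v)
    {M : Matrix (m × Fin 2) (l × Fin 2) ℂ}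
    (hMA : ∀ x, M *ᵥ tensorVec x (v 0) = tensorVec (A *ᵥ x) (v 0))
    (hMB : ∀ x, M *ᵥ tensorVec x (v 1) = tensorVec (B *ᵥ x) (v 1)) :
    ‖M‖ ≤ 1 ↔ ‖matrixMoebius A B‖ ≤ √(1 - cosSq v) := by
  rw [norm_matrixMoebius_le_iff hA hB (Real.sqrt_nonneg _),
    Real.sq_sqrt (sub_nonneg.2 (cosSq_le_one v)), sub_sub_cancel,
    norm_le_iff_posSemidef M zero_le_one, one_pow, one_smul]
  have hα := sum_norm_sq_pos (hv.ne_zero 0)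
  have hβ := sum_norm_sq_pos (hv.ne_zero 1)
  set α := ∑ k, ‖v 0 k‖ ^ 2 with hαd
  set β := ∑ k, ‖v 1 k‖ ^ 2 with hβd
  set γ := star (v 0) ⬝ᵥ v 1 with hγd
  have hγ' : star (v 1) ⬝ᵥ v 0 = star γ := by
    rw [hγd, Matrix.star_dotProduct]
  have hW : (tensorCols l v)ᴴ * (1 - Mᴴ * M) * tensorCols l v =
      Matrix.fromBlocks (α • (1 - Aᴴ * A)) (γ • (1 - Aᴴ * B))
        (γ • (1 - Aᴴ * B))ᴴ (β • (1 - Bᴴ * B)) := by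
    have e1 : (tensorCols l v)ᴴ * (1 - Mᴴ * M) * tensorCols l v =
        (tensorCols l v)ᴴ * tensorCols l v - (Matrix.fromBlocks A 0 0 B)ᴴ *
          ((tensorCols m v)ᴴ * tensorCols m v) * Matrix.fromBlocks A 0 0 B := by
      have e2 : (tensorCols l v)ᴴ * (Mᴴ * M) * tensorCols l v =
          (M * tensorCols l v)ᴴ * (M * tensorCols l v) := by
        rw [Matrix.conjTranspose_mul]
        simp only [Matrix.mul_assoc]
      rw [Matrix.mul_sub, Matrix.sub_mul, Matrix.mul_one, e2, mul_tensorCols hMA hMB,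
        Matrix.conjTranspose_mul]
      simp only [Matrix.mul_assoc]
    rw [e1, tensorCols_gram, tensorCols_gram, Matrix.fromBlocks_conjTranspose,
      Matrix.fromBlocks_multiply, Matrix.fromBlocks_multiply, sub_eq_add_neg,
      Matrix.fromBlocks_neg, Matrix.fromBlocks_add, hγ',
      star_dotProduct_self, star_dotProduct_self]
    congr 1 <;> simp [smul_sub, Matrix.conjTranspose_smul, ← hαd, ← hβd, ← hγd,
      Matrix.conjTranspose_mul] <;> rfl
  have hiff : (1 - Mᴴ * M).PosSemidef ↔
      ((tensorCols l v)ᴴ * (1 - Mᴴ * M) * tensorCols l v).PosSemidef := by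
    refine ⟨fun h => h.conjTranspose_mul_mul_same _, fun h => ?_⟩
    obtain ⟨W, hW1⟩ := exists_tensorCols_mul_eq_one (l := l) hv
    have h2 := h.conjTranspose_mul_mul_same W
    have e : Wᴴ * ((tensorCols l v)ᴴ * (1 - Mᴴ * M) * tensorCols l v) * W =
        (tensorCols l v * W)ᴴ * (1 - Mᴴ * M) * (tensorCols l v * W) := by
      rw [Matrix.conjTranspose_mul]
      simp only [Matrix.mul_assoc]
    rwa [e, hW1, Matrix.conjTranspose_one, Matrix.one_mul, Matrix.mul_one] at h2
  have hP : (α • (1 - Aᴴ * A)).PosDef := (posDef_one_sub hA).smul hα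
  have := hP.isUnit.invertible
  rw [hiff, hW, Matrix.PosDef.fromBlocks₁₁ _ _ hP]
  have hinv : (α • (1 - Aᴴ * A))⁻¹ = α⁻¹ • (1 - Aᴴ * A)⁻¹ := by
    apply Matrix.inv_eq_right_inv
    rw [Matrix.smul_mul, Matrix.mul_smul, smul_smul, mul_inv_cancel₀ hα.ne', one_smul,
      Matrix.mul_nonsing_inv _ ((Matrix.isUnit_iff_isUnit_det _).1 (posDef_one_sub hA).isUnit)]
  have hfin : β • (1 - Bᴴ * B) - (γ • (1 - Aᴴ * B))ᴴ * (α • (1 - Aᴴ * A))⁻¹ * (γ • (1 - Aᴴ * B)) =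
      β • ((1 - Bᴴ * B) -
        cosSq v • ((1 - Aᴴ * B)ᴴ * (1 - Aᴴ * A)⁻¹ * (1 - Aᴴ * B))) := by
    rw [hinv, Matrix.conjTranspose_smul, smul_sub β (1 - Bᴴ * B) (cosSq v • _), smul_smul β]
    congr 1
    simp only [Matrix.smul_mul, Matrix.mul_smul]
    generalize (1 - Aᴴ * B)ᴴ * (1 - Aᴴ * A)⁻¹ * (1 - Aᴴ * B) = X
    ext i j
    simp only [Matrix.smul_apply, Complex.real_smul, smul_eq_mul]
    have e3 : β * cosSq v = ‖γ‖ ^ 2 * α⁻¹ := by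
      rw [cosSq, ← hαd, ← hβd, ← hγd]; field_simp
    have e4 : star γ * γ = ((‖γ‖ ^ 2 : ℝ) : ℂ) := by
      rw [Complex.ofReal_pow, ← Complex.conj_mul']; rfl
    rw [e3, Complex.ofReal_mul, ← e4]
    ring
  rw [hfin, posSemidef_smul_iff hβ]

end

/-! ### The operator norm as a supremum of scalar pairings -/

section

variable {m l : Type*} [Fintype m] [Fintype l] [DecidableEq l]

theorem matrix_norm_le_of_dotProduct (M : Matrix m l ℂ) {c : ℝ} (hc : 0 ≤ c)
    (h : ∀ (u : EuclideanSpace ℂ m) (x : EuclideanSpace ℂ l),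
      ‖star u.ofLp ⬝ᵥ (M *ᵥ x.ofLp)‖ ≤ c * (‖u‖ * ‖x‖)) : ‖M‖ ≤ c := by
  rw [Matrix.l2_opNorm_def]
  refine ContinuousLinearMap.opNorm_le_bound _ hc fun x => ?_
  set y : EuclideanSpace ℂ m := WithLp.toLp 2 (M *ᵥ x.ofLp) with hy
  change ‖y‖ ≤ _
  have h1 := h y x
  have h2 : star y.ofLp ⬝ᵥ (M *ᵥ x.ofLp) = ((‖y‖ ^ 2 : ℝ) : ℂ) := by
    rw [EuclideanSpace.norm_sq_eq]
    simp [hy, dotProduct, Complex.conj_mul']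
  rw [h2, Complex.norm_real, Real.norm_of_nonneg (by positivity)] at h1
  rcases (norm_nonneg y).eq_or_lt with h0 | h0
  · rw [← h0]; positivity
  · nlinarith

theorem norm_dotProduct_mulVec_le (M : Matrix m l ℂ) (u : EuclideanSpace ℂ m)
    (x : EuclideanSpace ℂ l) : ‖star u.ofLp ⬝ᵥ (M *ᵥ x.ofLp)‖ ≤ ‖M‖ * (‖u‖ * ‖x‖) := by
  have h := norm_inner_le_norm (𝕜 := ℂ) u (WithLp.toLp 2 (M *ᵥ x.ofLp))
  have e : inner ℂ u (WithLp.toLp 2 (M *ᵥ x.ofLp)) = star u.ofLp ⬝ᵥ (M *ᵥ x.ofLp) := by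
    rw [PiLp.inner_apply]
    simp [dotProduct, mul_comm]
  rw [e] at h
  have h2 : ‖WithLp.toLp 2 (M *ᵥ x.ofLp)‖ ≤ ‖M‖ * ‖x‖ := Matrix.l2_opNorm_mulVec M x
  calc _ ≤ ‖u‖ * (‖M‖ * ‖x‖) := h.trans (by gcongr)
    _ = _ := by ring

end

end MatrixMoebius

/-! ### Interpolation and means on the disk -/

section MoebiusDistance

open Complex Set Metric Topology

open scoped ComplexConjugate

/-- Shrinking by `r` contracts the pseudo-hyperbolic distance by `2r / (1 + r²)`, the distance
between `r` and `-r`. The factor is strictly below `1`, and this gain pays for distances that are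
only approximated. With `w = conj v * u` the claim reduces to `(1 + r²)|1 - w| ≤ 2|1 - r²w|`, sharp
at `w = -1`. -/
theorem pseudoHyperbolic_scale {u v : ℂ} (hu : ‖u‖ ≤ 1) (hv : ‖v‖ ≤ 1) {r c : ℝ} (hr0 : 0 < r)
    (hr1 : r < 1) (h : ‖u - v‖ ≤ c * ‖1 - conj v * u‖) (hc : 0 ≤ c) :
    ‖r * u - r * v‖ ≤ 2 * r / (1 + r ^ 2) * c * ‖1 - conj (r * v) * (r * u)‖ := by
  have key : ‖1 - conj v * u‖ * (1 + r ^ 2) ≤ 2 * ‖1 - conj (r * v) * (r * u)‖ := by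
    set w := conj v * u with hw
    have hw1 : ‖w‖ ≤ 1 := by
      rw [hw, norm_mul, RCLike.norm_conj]; nlinarith [norm_nonneg u, norm_nonneg v]
    have e : conj (r * v) * (r * u) = ((r ^ 2 : ℝ) : ℂ) * w := by
      simp [hw]; ring
    rw [e]
    have h1 : ‖w‖ ^ 2 = w.re ^ 2 + w.im ^ 2 := by
      rw [← Complex.normSq_eq_norm_sq, Complex.normSq_apply]; ring
    have h2 : ‖1 - w‖ ^ 2 = (1 - w.re) ^ 2 + w.im ^ 2 := by
      rw [← Complex.normSq_eq_norm_sq, Complex.normSq_apply]; simp; ring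
    have h3 : ‖1 - ((r ^ 2 : ℝ) : ℂ) * w‖ ^ 2 = (1 - r ^ 2 * w.re) ^ 2 + (r ^ 2 * w.im) ^ 2 := by
      rw [← Complex.normSq_eq_norm_sq, Complex.normSq_apply, Complex.sub_re, Complex.sub_im,
        Complex.re_ofReal_mul, Complex.im_ofReal_mul]; simp; ring
    have h4 : |w.re| ≤ 1 := (Complex.abs_re_le_norm w).trans hw1
    have h5 : -1 ≤ w.re := (abs_le.1 h4).1
    have h6 : w.re ^ 2 + w.im ^ 2 ≤ 1 := by rw [← h1]; nlinarith [norm_nonneg w]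
    refine le_of_sq_le_sq ?_ (by positivity)
    rw [mul_pow, mul_pow, h2, h3]
    have h7 : 0 ≤ 1 - r ^ 2 := by nlinarith
    have h8 : 0 ≤ 3 + r ^ 2 + 2 * w.re * (1 - r ^ 2) - (w.re ^ 2 + w.im ^ 2) * (1 + 3 * r ^ 2) := by
      nlinarith [mul_nonneg h7 (by linarith : 0 ≤ w.re + 1),
        mul_nonneg (by positivity : 0 ≤ 1 + 3 * r ^ 2) (sub_nonneg.2 h6)]
    nlinarith [mul_nonneg h7 h8]
  have h1 : ‖r * u - r * v‖ = r * ‖u - v‖ := by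
    rw [← mul_sub, norm_mul, Complex.norm_real, Real.norm_of_nonneg hr0.le]
  rw [h1, div_mul_eq_mul_div, div_mul_eq_mul_div, le_div_iff₀ (by positivity)]
  calc r * ‖u - v‖ * (1 + r ^ 2) ≤ r * (c * ‖1 - conj v * u‖) * (1 + r ^ 2) := by gcongr
    _ = r * c * (‖1 - conj v * u‖ * (1 + r ^ 2)) := by ring
    _ ≤ r * c * (2 * ‖1 - conj (r * v) * (r * u)‖) := by gcongr
    _ = _ := by ring

theorem norm_add_div_le_one {a w : ℂ} (ha : ‖a‖ < 1) (hw : ‖w‖ ≤ 1) :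
    ‖(a + w) / (1 + conj a * w)‖ ≤ 1 := by
  have h0 : 0 ≤ (1 - ‖a‖ ^ 2) * (1 - ‖w‖ ^ 2) :=
    mul_nonneg (by nlinarith [norm_nonneg a]) (by nlinarith [norm_nonneg w])
  have h1 : ‖a + w‖ ≤ ‖1 + conj a * w‖ := by
    refine le_of_sq_le_sq ?_ (norm_nonneg _)
    simp only [← Complex.normSq_eq_norm_sq, Complex.normSq_apply] at h0 ⊢
    simp at h0 ⊢
    nlinarith
  rw [norm_div]
  exact div_le_one_of_le₀ h1 (norm_nonneg _)

theorem one_add_conj_mul_ne_zero {a w : ℂ} (ha : ‖a‖ < 1) (hw : ‖w‖ ≤ 1) :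
    1 + conj a * w ≠ 0 := by
  intro h
  have h1 : ‖conj a * w‖ = 1 := by
    rw [show conj a * w = -1 by linear_combination h]; simp
  rw [norm_mul, RCLike.norm_conj] at h1
  nlinarith [norm_nonneg a, norm_nonneg w]

/-- By Schwarz–Pick interpolation there is `k` from the closed disk to itself with `k 0 = α`, `k s =
β`. Cauchy's formula for `O * k` at `s` and at `0` has difference kernel `z / (z - s) - 1 = s / (z -
s)`, and `|k| ≤ 1` drops out. -/
theorem norm_sub_le_circle_mean {O : ℂ → ℂ} (hO : Differentiable ℂ O) {s : ℝ} (hs0 : 0 < s)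
    (hs1 : s < 1) {α β : ℂ} (hα : ‖α‖ < 1) (hβ : ‖β‖ < 1)
    (h : ‖β - α‖ ≤ s * ‖1 - conj α * β‖) :
    ‖O s * β - O 0 * α‖ ≤
      s * Real.circleAverage (fun z => ‖O z‖ / ‖z - s‖) 0 1 := by
  have hs : (s : ℂ) ≠ 0 := by exact_mod_cast hs0.ne'
  have hd : 1 - conj α * β ≠ 0 := by
    have := one_add_conj_mul_ne_zero (a := α) (w := -β) hα (by simpa using hβ.le)
    simpa [sub_eq_add_neg] using this
  set γ : ℂ := (β - α) / ((1 - conj α * β) * s) with hγ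
  have hγ1 : ‖γ‖ ≤ 1 := by
    rw [hγ, norm_div, norm_mul, Complex.norm_real, Real.norm_of_nonneg hs0.le]
    apply div_le_one_of_le₀ _ (by positivity)
    linarith
  set k : ℂ → ℂ := fun z => (α + γ * z) / (1 + conj α * (γ * z)) with hk
  have hγz : ∀ z : ℂ, ‖z‖ ≤ 1 → ‖γ * z‖ ≤ 1 := fun z hz => by
    rw [norm_mul]; nlinarith [norm_nonneg γ, norm_nonneg z]
  have hkn : ∀ z : ℂ, ‖z‖ ≤ 1 → ‖k z‖ ≤ 1 := fun z hz => norm_add_div_le_one hα (hγz z hz)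
  have hk0 : k 0 = α := by simp [hk]
  have hks : k s = β := by
    have e : γ * s = (β - α) / (1 - conj α * β) := by rw [hγ]; field_simp
    have hne := one_add_conj_mul_ne_zero hα (hγz s (by
      rw [Complex.norm_real, Real.norm_of_nonneg hs0.le]; exact hs1.le))
    simp only [hk]
    rw [div_eq_iff hne, e]
    have hq := mul_div_cancel₀ (β - α) hd
    linear_combination hq
  have hH : DiffContOnCl ℂ (fun z => O z * k z) (ball 0 |1|) := by
    apply DifferentiableOn.diffContOnCl
    rw [abs_one, closure_ball _ one_ne_zero]
    intro z hz
    have hz : ‖z‖ ≤ 1 := by simpa using hz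
    apply DifferentiableAt.differentiableWithinAt
    refine (hO z).mul (DifferentiableAt.div (by fun_prop) (by fun_prop) ?_)
    exact one_add_conj_mul_ne_zero hα (hγz z hz)
  have hcont : ContinuousOn (fun z => O z * k z) (sphere 0 |1|) := by
    have := hH.continuousOn
    rw [abs_one, closure_ball _ one_ne_zero] at this
    rw [abs_one]
    exact this.mono sphere_subset_closedBall
  have hne : ∀ z ∈ sphere (0 : ℂ) |1|, z ≠ 0 ∧ z - s ≠ 0 := by
    intro z hz
    have hz : ‖z‖ = 1 := by simpa using hz
    constructor
    · rintro rfl; simp at hz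
    · intro h
      rw [sub_eq_zero.1 h, Complex.norm_real, Real.norm_of_nonneg hs0.le] at hz
      exact hs1.ne hz
  have c1 := hH.circleAverage_smul_div (w := (s : ℂ))
    (by simp [abs_of_pos hs0, hs1])
  have c0 := hH.circleAverage_smul_div (w := (0 : ℂ)) (by simp)
  simp only [hk0, hks, sub_zero] at c0 c1
  rw [← c1, ← c0, ← Real.circleAverage_sub]
  rotate_left
  · refine ContinuousOn.circleIntegrable' ?_
    have h1 : ContinuousOn (fun z : ℂ => z / (z - s)) (sphere 0 |1|) :=
      ContinuousOn.div (by fun_prop) (by fun_prop) fun z hz => (hne z hz).2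
    exact h1.smul hcont
  · refine ContinuousOn.circleIntegrable' ?_
    have h1 : ContinuousOn (fun z : ℂ => z / z) (sphere 0 |1|) :=
      ContinuousOn.div (by fun_prop) (by fun_prop) fun z hz => (hne z hz).1
    exact h1.smul hcont
  rw [Real.circleAverage_def, Real.circleAverage_def, norm_smul, smul_eq_mul, mul_left_comm,
    Real.norm_of_nonneg (by positivity)]
  refine mul_le_mul_of_nonneg_left ?_ (by positivity)
  rw [← intervalIntegral.integral_const_mul]
  apply intervalIntegral.norm_integral_le_of_norm_le (by positivity)
  · refine Filter.Eventually.of_forall fun θ _ => ?_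
    have hz : ‖circleMap 0 1 θ‖ = 1 := by simp
    have hz' := hne (circleMap 0 1 θ) (by simp)
    generalize circleMap 0 1 θ = z at hz hz'
    simp only [Pi.sub_apply, smul_eq_mul]
    have e : z / (z - s) * (O z * k z) - z / z * (O z * k z) = s * (O z * k z) / (z - s) := by
      have := hz'.1; have := hz'.2
      field_simp
      ring
    rw [e, norm_div, norm_mul, norm_mul, Complex.norm_real, Real.norm_of_nonneg hs0.le,
      ← mul_div_assoc]
    gcongr
    exact mul_le_of_le_one_right (norm_nonneg _) (hkn z hz.le)
  · apply Continuous.intervalIntegrable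
    refine continuous_const.mul (Continuous.div ?_ ?_ ?_)
    · exact (hO.continuous.comp (continuous_circleMap 0 1)).norm
    · exact ((continuous_circleMap 0 1).sub continuous_const).norm
    · intro θ; simpa using (hne (circleMap 0 1 θ) (by simp)).2

/-- A positive continuous function on the circle is up to a factor close to `1` the modulus of
the exponential of an entire function. -/
theorem exists_norm_exp_approx (N : C(Circle, ℝ)) (hN : ∀ z, 0 < N z) {ε : ℝ} (hε : 0 < ε) :
    ∃ h : ℂ → ℂ, Differentiable ℂ h ∧
      ∀ z : Circle, N z ≤ ‖exp (h z)‖ ∧ ‖exp (h z)‖ ≤ (1 + ε) * N z := by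
  have : Fact (0 < 2 * Real.pi) := ⟨Real.two_pi_pos⟩
  -- On the circle `Re (c z⁻ᵐ) = Re (c̄ zᵐ)`, so negative frequencies can be reflected to positive
  -- ones and the real part of a trigonometric polynomial is that of a polynomial.
  have hre : ∀ t ∈ Submodule.span ℂ (range (@fourier (2 * Real.pi))),
      ∃ h : ℂ → ℂ, Differentiable ℂ h ∧ ∀ x, (t x).re = (h (AddCircle.toCircle x)).re := by
    intro t ht
    have gen : ∀ (c : ℂ) (n : ℤ), ∃ h : ℂ → ℂ, Differentiable ℂ h ∧
        ∀ x : AddCircle (2 * Real.pi), (c * fourier n x).re = (h (AddCircle.toCircle x)).re := by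
      intro c n
      rcases Int.eq_nat_or_neg n with ⟨m, rfl | rfl⟩
      · refine ⟨fun z => c * z ^ m, by fun_prop, fun x => ?_⟩
        simp [AddCircle.toCircle_nsmul]
      · refine ⟨fun z => conj c * z ^ m, by fun_prop, fun x => ?_⟩
        rw [fourier_neg, ← Complex.conj_re]
        simp [AddCircle.toCircle_nsmul]
    obtain ⟨l, rfl⟩ := (Finsupp.mem_span_range_iff_exists_finsupp).1 ht
    choose h hd he using gen
    refine ⟨fun z => l.sum fun n c => h c n z, ?_, fun x => ?_⟩
    · simp only [Finsupp.sum]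
      exact Differentiable.fun_sum fun n _ => hd _ _
    · simp only [Finsupp.sum, ContinuousMap.coe_sum, Finset.sum_apply, Complex.re_sum]
      refine Finset.sum_congr rfl fun n _ => ?_
      rw [← he]; simp
  obtain ⟨δ, hδ, hδε⟩ : ∃ δ > 0, Real.exp (2 * δ) = 1 + ε :=
    ⟨Real.log (1 + ε) / 2, by have := Real.log_pos (by linarith : 1 < 1 + ε); positivity, by
      rw [mul_div_cancel₀ _ two_ne_zero, Real.exp_log (by linarith)]⟩
  let lN : C(AddCircle (2 * Real.pi), ℂ) :=
    ⟨fun x => ((Real.log (N (AddCircle.toCircle x)) : ℝ) : ℂ), by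
      refine Complex.continuous_ofReal.comp (Continuous.log ?_ fun x => (hN _).ne')
      exact N.continuous.comp AddCircle.continuous_toCircle⟩
  have hmem : lN ∈ (Submodule.span ℂ (range (@fourier (2 * Real.pi)))).topologicalClosure := by
    rw [span_fourier_closure_eq_top]; trivial
  rw [← SetLike.mem_coe, Submodule.topologicalClosure_coe, Metric.mem_closure_iff] at hmem
  obtain ⟨t, ht, hlt⟩ := hmem δ hδ
  obtain ⟨h, hd, he⟩ := hre t ht
  -- The shift by `δ` makes the error one-sided: it lies in `[0, 2δ]`, and `exp (2δ) = 1 + ε`.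
  refine ⟨fun z => h z + δ, by fun_prop, fun z => ?_⟩
  obtain ⟨x, rfl⟩ : ∃ x : AddCircle (2 * Real.pi), AddCircle.toCircle x = z :=
    ⟨(Complex.arg z : ℝ), by
      rw [AddCircle.toCircle_apply_mk, div_self Real.two_pi_pos.ne', one_mul, Circle.exp_arg]⟩
  have h1 : |Real.log (N (AddCircle.toCircle x)) - (t x).re| ≤ δ := by
    have h2 : ‖(lN - t) x‖ ≤ δ := ((lN - t).norm_coe_le_norm x).trans
      (by rw [← dist_eq_norm]; exact hlt.le)
    refine le_trans ?_ h2
    refine le_trans (le_of_eq ?_) (Complex.abs_re_le_norm _)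
    simp [lN]
  rw [abs_le] at h1
  rw [Complex.norm_exp, Complex.add_re, ← he, Complex.ofReal_re]
  constructor
  · rw [← Real.log_le_iff_le_exp (hN _)]; linarith
  · rw [← Real.le_log_iff_exp_le (by have := hN (AddCircle.toCircle x); positivity),
      Real.log_mul (by positivity) (hN _).ne', ← hδε, Real.log_exp]
    linarith

/-- The mean of a function over the unit circle. -/
noncomputable def circleMean (f : Circle → ℝ) : ℝ :=
  (2 * Real.pi)⁻¹ * ∫ θ in (0 : ℝ)..2 * Real.pi, f (Circle.exp θ)

theorem circleAverage_eq_circleMean (f : ℂ → ℝ) :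
    Real.circleAverage f 0 1 = circleMean fun z => f z := by
  simp [Real.circleAverage_def, circleMean, circleMap, Circle.coe_exp]

theorem circleMean_intervalIntegrable {f : Circle → ℝ} (hf : Continuous f) :
    IntervalIntegrable (fun θ : ℝ => f (Circle.exp θ)) MeasureTheory.volume 0 (2 * Real.pi) :=
  (hf.comp Circle.exp.continuous).intervalIntegrable _ _

theorem circleMean_mono {f g : Circle → ℝ} (hf : Continuous f) (hg : Continuous g)
    (h : ∀ z, f z ≤ g z) : circleMean f ≤ circleMean g := by
  refine mul_le_mul_of_nonneg_left ?_ (by positivity)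
  exact intervalIntegral.integral_mono_on (by positivity) (circleMean_intervalIntegrable hf)
    (circleMean_intervalIntegrable hg) fun θ _ => h _

theorem circleMean_add {f g : Circle → ℝ} (hf : Continuous f) (hg : Continuous g) :
    circleMean (fun z => f z + g z) = circleMean f + circleMean g := by
  rw [circleMean, intervalIntegral.integral_add (circleMean_intervalIntegrable hf)
    (circleMean_intervalIntegrable hg), mul_add]
  rfl

theorem circleMean_const_mul (c : ℝ) (f : Circle → ℝ) :
    circleMean (fun z => c * f z) = c * circleMean f := by
  rw [circleMean, intervalIntegral.integral_const_mul, mul_left_comm]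
  rfl

theorem circleMean_const (c : ℝ) : circleMean (fun _ => c) = c := by
  rw [circleMean, intervalIntegral.integral_const]
  have := Real.pi_pos
  simp only [sub_zero, smul_eq_mul]
  field_simp

/-! ### Bounded holomorphic functions and the key two-point estimate -/

/-- Bounded functions on a set, with the supremum norm. -/
abbrev BddFun {F : Type*} (Y : Set F) : Type _ := lp (fun _ : Y => ℂ) ∞

/-- Bounded holomorphic functions on a set `Y`. -/
def boundedHolomorphic {F : Type*} [NormedAddCommGroup F] [NormedSpace ℂ F] (Y : Set F) :
    Submodule ℂ (BddFun Y) where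
  carrier := {a | ∃ f : F → ℂ, DifferentiableOn ℂ f Y ∧ ∀ y : Y, a y = f y}
  add_mem' := by
    rintro a b ⟨f, hf, hfa⟩ ⟨g, hg, hgb⟩
    exact ⟨f + g, hf.add hg, fun y => by simp [hfa, hgb]⟩
  zero_mem' := ⟨0, differentiableOn_const _, fun y => rfl⟩
  smul_mem' := by
    rintro c a ⟨f, hf, hfa⟩
    exact ⟨c • f, hf.const_smul c, fun y => by simp [hfa]⟩

/-- Holomorphic functions from `Y` to the closed disk do not spread `p` and `q` further apart
than the pseudo-hyperbolic distance `c`. -/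
def TwoPointBound {F : Type*} [NormedAddCommGroup F] [NormedSpace ℂ F] (Y : Set F)
    (p q : F) (c : ℝ) : Prop :=
  ∀ f : F → ℂ, DifferentiableOn ℂ f Y → (∀ y ∈ Y, ‖f y‖ ≤ 1) →
    ‖f q - f p‖ ≤ c * ‖1 - conj (f p) * f q‖

section

variable {V : Type*} [NormedAddCommGroup V] [NormedSpace ℂ V] {𝒜 : Submodule ℂ V}

/-- The value at `z` of a polynomial with coefficients in a subspace of a normed space. -/
noncomputable def polyValue (g : ℕ →₀ 𝒜) (z : ℂ) : V :=
  g.sum fun n a => z ^ n • (a : V)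

theorem continuous_polyValue (g : ℕ →₀ 𝒜) : Continuous (polyValue g) := by
  unfold polyValue Finsupp.sum
  fun_prop

end

section

variable {F : Type*} [NormedAddCommGroup F] [NormedSpace ℂ F] {Y : Set F}

theorem polyValue_apply (g : ℕ →₀ boundedHolomorphic Y) (z : ℂ) (y : Y) :
    polyValue g z y = g.sum fun n a => z ^ n * (a : BddFun Y) y := by
  rw [polyValue, Finsupp.sum, lp.coeFn_sum]
  exact Finset.sum_apply _ _ _

/-- This is the seminorm bound that Hahn–Banach will need. Dividing `g` by an outer function of
nearly the same size on the circle and substituting `γ` for the variable gives a function on `Y`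
bounded by `1`; the two-point bound on it, shrunk by `r`, feeds `norm_sub_le_circle_mean`. -/
theorem norm_polyValue_sub_le {p q : Y} {c r s : ℝ} (hY : TwoPointBound Y (p : F) q c)
    (hc : 0 ≤ c) {γ : F → ℂ} (hγ : DifferentiableOn ℂ γ Y) (hγ1 : ∀ y ∈ Y, ‖γ y‖ ≤ 1)
    (hγp : γ p = 0) (hγq : γ q = s) (hs0 : 0 < s) (hs1 : s < 1) (hr0 : 0 < r) (hr1 : r < 1)
    (hrs : 2 * r / (1 + r ^ 2) * c ≤ s) (g : ℕ →₀ boundedHolomorphic Y) :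
    r * ‖polyValue g s q - polyValue g 0 p‖ ≤
      s * circleMean fun z => ‖polyValue g z‖ / ‖(z : ℂ) - s‖ := by
  have hne : ∀ z : Circle, ‖(z : ℂ) - s‖ ≠ 0 := by
    intro z h
    have h1 : ‖(z : ℂ)‖ = 1 := Circle.norm_coe z
    rw [sub_eq_zero.1 (norm_eq_zero.1 h), Complex.norm_real, Real.norm_of_nonneg hs0.le] at h1
    exact hs1.ne h1
  have hcs : Continuous fun z : Circle => ‖(z : ℂ) - s‖ := by fun_prop
  have hcg : Continuous fun z : Circle => ‖polyValue g z‖ :=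
    ((continuous_polyValue g).comp continuous_subtype_val).norm
  have step : ∀ ε : ℝ, 0 < ε → r * ‖polyValue g s q - polyValue g 0 p‖ ≤
      s * ((1 + ε) * (circleMean (fun z => ‖polyValue g z‖ / ‖(z : ℂ) - s‖) +
        ε * circleMean fun z => 1 / ‖(z : ℂ) - s‖)) := by
    intro ε hε
    -- Adding `ε` keeps the modulus positive where `polyValue g` vanishes.
    obtain ⟨h, hd, hh⟩ := exists_norm_exp_approx ⟨fun z => ‖polyValue g z‖ + ε, by fun_prop⟩
      (fun z => by simp only [ContinuousMap.coe_mk]; positivity) hε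
    simp only [ContinuousMap.coe_mk] at hh
    have hrep : ∀ a : boundedHolomorphic Y, ∃ f : F → ℂ, DifferentiableOn ℂ f Y ∧
        ∀ y : Y, (a : BddFun Y) y = f y := fun a => a.2
    choose rep hrd hre using hrep
    set f : F → ℂ := fun x => (g.sum fun n a => γ x ^ n * rep a x) * exp (-h (γ x)) with hf
    have hval : ∀ y : Y, f y = polyValue g (γ y) y * exp (-h (γ y)) := by
      intro y
      simp only [hf, polyValue_apply, hre]
    have hfd : DifferentiableOn ℂ f Y := by
      have h1 : DifferentiableOn ℂ (fun x => h (γ x)) Y := hd.comp_differentiableOn hγ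
      refine DifferentiableOn.mul ?_ h1.neg.cexp
      simp only [Finsupp.sum]
      exact DifferentiableOn.fun_sum fun n _ => (hγ.pow n).mul (hrd _)
    -- Maximum principle in `z` with `y` fixed; it then applies at `z = γ y`.
    have hL : ∀ (y : Y) (z : ℂ), ‖z‖ ≤ 1 → ‖polyValue g z y * exp (-h z)‖ ≤ 1 := by
      intro y z hz
      refine Complex.norm_le_of_forall_mem_frontier_norm_le (U := ball 0 1) isBounded_ball
        (f := fun z => polyValue g z y * exp (-h z)) (Differentiable.diffContOnCl ?_) ?_ ?_
      · simp only [polyValue_apply, Finsupp.sum]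
        fun_prop
      · intro w hw
        rw [frontier_ball _ one_ne_zero, mem_sphere_zero_iff_norm] at hw
        have h1 := (hh ⟨w, mem_sphere_zero_iff_norm.2 hw⟩).1
        simp only at h1
        rw [norm_mul, Complex.exp_neg, norm_inv, ← div_eq_mul_inv]
        refine div_le_one_of_le₀ (le_trans ?_ h1) (norm_nonneg _)
        exact (lp.norm_apply_le_norm ENNReal.top_ne_zero (polyValue g w) y).trans (by simp [hε.le])
      · rw [closure_ball _ one_ne_zero]; simpa using hz
    have hf1 : ∀ y ∈ Y, ‖f y‖ ≤ 1 := fun y hy => by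
      rw [hval ⟨y, hy⟩]; exact hL _ _ (hγ1 y hy)
    have htwo := pseudoHyperbolic_scale (hf1 q q.2) (hf1 p p.2) hr0 hr1 (hY f hfd hf1) hc
    have hlt : ∀ y ∈ Y, ‖r * f y‖ < 1 := fun y hy => by
      rw [norm_mul, Complex.norm_real, Real.norm_of_nonneg hr0.le]
      nlinarith [hf1 y hy, norm_nonneg (f y)]
    have hmain := norm_sub_le_circle_mean (O := fun z => exp (h z)) (by fun_prop) hs0 hs1
      (hlt p p.2) (hlt q q.2)
      (htwo.trans (mul_le_mul_of_nonneg_right hrs (norm_nonneg _)))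
    rw [circleAverage_eq_circleMean] at hmain
    have e : ∀ z y, exp (h z) * (r * (polyValue g z y * exp (-h z))) = r * polyValue g z y := by
      intro z y
      rw [Complex.exp_neg]
      field_simp [Complex.exp_ne_zero]
    rw [hval q, hval p, hγp, hγq, e, e, ← mul_sub, norm_mul, Complex.norm_real,
      Real.norm_of_nonneg hr0.le] at hmain
    refine hmain.trans (mul_le_mul_of_nonneg_left ?_ hs0.le)
    rw [← circleMean_const_mul, ← circleMean_add, ← circleMean_const_mul]
    · refine circleMean_mono ?_ ?_ fun z => ?_
      · have : Continuous fun z : Circle => ‖exp (h z)‖ := by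
          have := hd.continuous
          fun_prop
        exact this.div hcs hne
      · exact continuous_const.mul ((hcg.div hcs hne).add (continuous_const.mul
          (continuous_const.div hcs hne)))
      · have := hne z
        rw [div_le_iff₀ (lt_of_le_of_ne (norm_nonneg _) (Ne.symm this))]
        refine (hh z).2.trans (le_of_eq ?_)
        field_simp
    · exact hcg.div hcs hne
    · exact continuous_const.mul (continuous_const.div hcs hne)
  set A := circleMean fun z => ‖polyValue g z‖ / ‖(z : ℂ) - s‖
  set B := circleMean fun z : Circle => 1 / ‖(z : ℂ) - s‖
  have ht : Filter.Tendsto (fun ε : ℝ => s * ((1 + ε) * (A + ε * B))) (𝓝[>] 0) (𝓝 (s * A)) := by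
    have : ContinuousAt (fun ε : ℝ => s * ((1 + ε) * (A + ε * B))) 0 := by fun_prop
    have h2 := this.tendsto.mono_left (nhdsWithin_le_nhds (s := Ioi 0))
    simpa using h2
  exact ge_of_tendsto ht (eventually_nhdsWithin_of_forall fun ε hε => step ε hε)

end

/-! ### Cauchy kernels and holomorphic families of functionals -/

section

variable {V : Type*} [NormedAddCommGroup V] [NormedSpace ℂ V]

/-- The map `(w, a) ↦ (z ↦ w(z) a)`. -/
noncomputable def circleTensor : C(Circle, ℂ) →L[ℂ] V →L[ℂ] C(Circle, V) :=
  LinearMap.mkContinuous₂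
    (LinearMap.mk₂ ℂ (fun (w : C(Circle, ℂ)) (a : V) => (⟨fun z => w z • a, by fun_prop⟩ : C(Circle, V)))
      (fun w w' a => ContinuousMap.ext fun z => add_smul (w z) (w' z) a)
      (fun c w a => ContinuousMap.ext fun z => smul_assoc c (w z) a)
      (fun w a b => ContinuousMap.ext fun z => smul_add (w z) a b)
      (fun c w a => ContinuousMap.ext fun z => smul_comm (w z) c a)) 1
    (fun w a => by
      rw [one_mul, ContinuousMap.norm_le _ (by positivity)]
      intro z
      simp only [LinearMap.mk₂_apply, ContinuousMap.coe_mk, norm_smul]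
      gcongr
      exact w.norm_coe_le_norm z)

@[simp]
theorem circleTensor_apply (w : C(Circle, ℂ)) (a : V) (z : Circle) :
    circleTensor w a z = w z • a := rfl

/-- The `L¹` seminorm on continuous functions on the circle. -/
noncomputable def circleSeminorm : Seminorm ℂ C(Circle, V) :=
  Seminorm.of (fun G => circleMean fun z => ‖G z‖)
    (fun G H => by
      rw [← circleMean_add (by fun_prop) (by fun_prop)]
      exact circleMean_mono (by fun_prop) (by fun_prop) fun z => norm_add_le _ _)
    (fun c G => by
      simp only [ContinuousMap.smul_apply, norm_smul]
      exact circleMean_const_mul _ _)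

theorem circleSeminorm_apply (G : C(Circle, V)) :
    circleSeminorm G = circleMean fun z => ‖G z‖ := rfl

theorem circleSeminorm_le (G : C(Circle, V)) : circleSeminorm G ≤ ‖G‖ := by
  rw [circleSeminorm_apply, ← circleMean_const ‖G‖]
  exact circleMean_mono (by fun_prop) (by fun_prop) fun z => G.norm_coe_le_norm z

end

/-- The function `z ↦ z` on the unit circle. -/
def circleCoe : C(Circle, ℂ) := ⟨fun z => z, by fun_prop⟩

@[simp]
theorem circleCoe_apply (z : Circle) : circleCoe z = z := rfl

theorem norm_smul_star_circleCoe_lt {l : ℂ} (hl : ‖l‖ < 1) : ‖l • star circleCoe‖ < 1 := by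
  rw [ContinuousMap.norm_lt_iff _ one_pos]
  intro z
  rw [ContinuousMap.smul_apply, norm_smul, ContinuousMap.star_apply, norm_star, circleCoe_apply,
    Circle.norm_coe, mul_one]
  exact hl

/-- The Cauchy kernel `z ↦ z / (z - l)` on the unit circle. -/
noncomputable def circleKernel (l : ℂ) : C(Circle, ℂ) := Ring.inverse (1 - l • star circleCoe)

theorem differentiableOn_circleKernel : DifferentiableOn ℂ circleKernel (ball 0 1) := by
  intro l hl
  have hl : ‖l‖ < 1 := by simpa using hl
  apply DifferentiableAt.differentiableWithinAt
  have h1 : DifferentiableAt ℂ (fun l : ℂ => 1 - l • star circleCoe) l := by fun_prop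
  exact DifferentiableAt.comp l (differentiableAt_inverse
    (isUnit_one_sub_of_norm_lt_one (norm_smul_star_circleCoe_lt hl))) h1

theorem circle_sub_ne_zero {l : ℂ} (hl : ‖l‖ < 1) (z : Circle) : (z : ℂ) - l ≠ 0 := by
  intro h
  rw [← sub_eq_zero.1 h, Circle.norm_coe] at hl
  exact lt_irrefl _ hl

theorem circleKernel_apply {l : ℂ} (hl : ‖l‖ < 1) (z : Circle) :
    circleKernel l z = z / (z - l) := by
  have h := congrArg (fun w : C(Circle, ℂ) => w z) (Ring.inverse_mul_cancel _
    (isUnit_one_sub_of_norm_lt_one (norm_smul_star_circleCoe_lt hl)))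
  simp only [ContinuousMap.mul_apply, ContinuousMap.sub_apply, ContinuousMap.one_apply,
    ContinuousMap.smul_apply, ContinuousMap.star_apply, circleCoe_apply, smul_eq_mul] at h
  have hz : (z : ℂ) ≠ 0 := z.coe_ne_zero
  have e : star (z : ℂ) = (z : ℂ)⁻¹ := by
    rw [← Circle.coe_inv, Circle.coe_inv_eq_conj]; rfl
  rw [e] at h
  rw [eq_div_iff (circle_sub_ne_zero hl z)]
  have h2 : Ring.inverse (1 - l • star circleCoe) z * (1 - l * (z : ℂ)⁻¹) * z = z := by
    rw [h, one_mul]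
  rw [circleKernel]
  rw [mul_assoc, sub_mul, mul_assoc, inv_mul_cancel₀ hz] at h2
  simpa using h2

/-- Only nonnegative powers of `z` occur, so a functional that kills the positive powers sees only
the constant term. -/
theorem hasSum_star_circleKernel {l : ℂ} (hl : ‖l‖ < 1) :
    HasSum (fun n : ℕ => (conj l ^ n) • circleCoe ^ n) (star (circleKernel l)) := by
  have h := hasSum_geom_series_inverse _ (norm_smul_star_circleCoe_lt hl)
  simpa only [star_pow, star_smul, smul_pow, star_star] using! h.star

/-- The bound forces `ell` to vanish on the kernel of `j`, so it descends to the range of `j`, where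
Hahn–Banach applies. -/
theorem exists_extension_comp_of_le_seminorm {V E : Type*} [AddCommGroup V] [Module ℂ V]
    [AddCommGroup E] [Module ℂ E] (j : V →ₗ[ℂ] E) (ell : V →ₗ[ℂ] ℂ) (N : Seminorm ℂ E)
    (h : ∀ v, ‖ell v‖ ≤ N (j v)) :
    ∃ L : E →ₗ[ℂ] ℂ, (∀ v, L (j v) = ell v) ∧ ∀ G, ‖L G‖ ≤ N G := by
  have hker : LinearMap.ker j ≤ LinearMap.ker ell := by
    intro g hg
    have := h g
    rw [LinearMap.mem_ker.1 hg, map_zero] at this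
    exact norm_le_zero_iff.1 this
  obtain ⟨f, hf⟩ : ∃ f : Module.Dual ℂ (LinearMap.range j), ∀ v, f (j.rangeRestrict v) = ell v := by
    refine ⟨(LinearMap.ker j).liftQ ell hker ∘ₗ j.quotKerEquivRange.symm.toLinearMap, fun g => ?_⟩
    have : j.quotKerEquivRange.symm (j.rangeRestrict g) = Submodule.Quotient.mk g := by
      rw [LinearEquiv.symm_apply_eq]; rfl
    simp [this]
  obtain ⟨L, hL, hLN⟩ := Module.Dual.exists_extension_of_le_seminorm (LinearMap.range j) f
    (p := N) (by
      rintro ⟨_, g, rfl⟩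
      have := h g
      rw [← hf g] at this
      exact this)
  exact ⟨L, fun v => (hL ⟨j v, v, rfl⟩).trans (hf v), hLN⟩

theorem circleMean_poissonKernel {l : ℂ} (hl : ‖l‖ < 1) :
    circleMean (fun z => poissonKernel 0 l z) = 1 := by
  rw [← circleAverage_eq_circleMean]
  have h := DiffContOnCl.circleAverage_poissonKernel_smul (f := fun _ => (1 : ℂ)) (c := 0)
    (R := 1) (w := l) diffContOnCl_const (by simpa using hl)
  have e : Real.circleAverage (poissonKernel 0 l • fun _ => (1 : ℂ)) 0 1 =
      ((Real.circleAverage (poissonKernel 0 l) 0 1 : ℝ) : ℂ) := by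
    simp [Real.circleAverage_def, intervalIntegral.integral_ofReal]
  rw [e] at h
  exact_mod_cast h

theorem poissonKernel_nonneg {l : ℂ} (hl : ‖l‖ < 1) (z : Circle) : 0 ≤ poissonKernel 0 l z := by
  rw [poissonKernel_def]
  simp only [sub_zero, Circle.norm_coe]
  have : ‖l‖ ^ 2 ≤ 1 := by nlinarith [norm_nonneg l]
  apply div_nonneg <;> nlinarith [sq_nonneg ‖(z : ℂ) - l‖]

theorem circleKernel_add_star {l : ℂ} (hl : ‖l‖ < 1) (z : Circle) :
    (circleKernel l + star (circleKernel l) - 1) z = ((poissonKernel 0 l z : ℝ) : ℂ) := by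
  have hz := circle_sub_ne_zero hl z
  rw [poissonKernel_eq_re_herglotzRieszKernel, Function.comp_apply, herglotzRieszKernel_def]
  simp only [ContinuousMap.sub_apply, ContinuousMap.add_apply, ContinuousMap.star_apply,
    circleKernel_apply hl, ContinuousMap.one_apply, sub_zero]
  rw [show ((z : ℂ) + l) / (z - l) = 2 * (z / (z - l)) - 1 by field_simp; ring]
  generalize (z : ℂ) / (z - l) = u
  apply Complex.ext <;> simp
  ring

/-- Linear interpolation of two functionals by a holomorphic family of functionals over the
unit disk. -/
theorem exists_holomorphic_family_of_bound {V : Type*} [NormedAddCommGroup V] [NormedSpace ℂ V]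
    {𝒜 : Submodule ℂ V} {e₀ e₁ : V →ₗ[ℂ] ℂ} {r s : ℝ} (hs0 : 0 < s) (hs1 : s < 1) (hr0 : 0 < r)
    (key : ∀ g : ℕ →₀ 𝒜, r * ‖e₁ (polyValue g s) - e₀ (polyValue g 0)‖ ≤
      s * circleMean fun z => ‖polyValue g z‖ / ‖(z : ℂ) - s‖) :
    ∃ φ : ℂ → V →L[ℂ] ℂ, DifferentiableOn ℂ φ (ball 0 1) ∧
      (∀ l ∈ ball (0 : ℂ) 1, ∀ a ∈ 𝒜, ‖φ l a‖ ≤ r⁻¹ * ‖a‖) ∧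
      ∀ a ∈ 𝒜, φ 0 a = e₀ a ∧ φ s a = e₁ a := by
  have hs : ‖(s : ℂ)‖ < 1 := by rwa [Complex.norm_real, Real.norm_of_nonneg hs0.le]
  have hsc : (s : ℂ) ≠ 0 := by exact_mod_cast hs0.ne'
  -- The factor `1 / (z - s)` absorbs the weight of the mean in `key`, which thereby becomes a plain
  -- `L¹` seminorm.
  let w : ℕ → C(Circle, ℂ) := fun n => ⟨fun z => (z : ℂ) ^ n / (z - s),
    Continuous.div (by fun_prop) (by fun_prop) fun z => circle_sub_ne_zero hs z⟩
  let j : (ℕ →₀ 𝒜) →ₗ[ℂ] C(Circle, V) :=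
    Finsupp.lsum ℂ fun n => (circleTensor (w n)).toLinearMap ∘ₗ 𝒜.subtype
  -- The factor `0 ^ n` is `1` for `n = 0` and `0` otherwise, so it selects the constant
  -- coefficient.
  let ell : (ℕ →₀ 𝒜) →ₗ[ℂ] ℂ :=
    Finsupp.lsum ℂ fun n => (((s : ℂ) ^ n / s) • e₁ - ((0 : ℂ) ^ n / s) • e₀) ∘ₗ
      𝒜.subtype
  have hj : ∀ g z, j g z = ((z : ℂ) - s)⁻¹ • polyValue g z := by
    intro g z
    simp only [j, Finsupp.lsum_apply, Finsupp.sum, polyValue, ContinuousMap.coe_sum,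
      Finset.sum_apply, Finset.smul_sum]
    refine Finset.sum_congr rfl fun n _ => ?_
    simp [w, smul_smul, div_eq_inv_mul]
  have hell : ∀ g, ell g = (e₁ (polyValue g s) - e₀ (polyValue g 0)) / s := by
    intro g
    simp only [ell, polyValue, Finsupp.lsum_apply, Finsupp.sum, map_sum, map_smul,
      ← Finset.sum_sub_distrib, Finset.sum_div]
    refine Finset.sum_congr rfl fun n _ => ?_
    simp
    ring
  have hbound : ∀ g, ‖ell g‖ ≤ r⁻¹ * circleSeminorm (j g) := by
    intro g
    have := key g
    rw [hell, norm_div, Complex.norm_real, Real.norm_of_nonneg hs0.le, circleSeminorm_apply]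
    simp only [hj, norm_smul, norm_inv, ← div_eq_inv_mul]
    rw [div_le_iff₀ hs0, div_mul_eq_mul_div, le_div_iff₀ hr0]
    linarith
  let N : Seminorm ℂ C(Circle, V) :=
    r⁻¹.toNNReal • circleSeminorm (V := V)
  have hN : ∀ G, N G = r⁻¹ * circleSeminorm G := fun G => by
    rw [smul_apply, NNReal.smul_def, Real.coe_toNNReal _ (by positivity), smul_eq_mul]
  obtain ⟨L, hLj, hLN⟩ := exists_extension_comp_of_le_seminorm j ell N fun g => by
    rw [hN]; exact hbound g
  -- The cruder sup-norm bound serves only for continuity, hence for holomorphy in `l`; the norm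
  -- estimate below uses the `L¹` seminorm.
  let L' : C(Circle, V) →L[ℂ] ℂ := L.mkContinuous r⁻¹ fun G =>
    (hLN G).trans (by rw [hN]; gcongr; exact circleSeminorm_le G)
  let Ψ : C(Circle, ℂ) →L[ℂ] V →L[ℂ] ℂ :=
    (ContinuousLinearMap.compL ℂ V C(Circle, V) ℂ L') ∘L circleTensor
  have hΨ : ∀ w a, Ψ w a = L (circleTensor w a) := fun _ _ => rfl
  have hΨw : ∀ n, ∀ a ∈ 𝒜, Ψ (w n) a = ((s : ℂ) ^ n * e₁ a - 0 ^ n * e₀ a) / s := by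
    intro n a ha
    have h1 : circleTensor (w n) a = j (Finsupp.single n ⟨a, ha⟩) := by simp [j]
    rw [hΨ, h1, hLj]
    simp [ell]
    ring
  -- Positive powers are killed because `s` is a root of `zⁿ⁺¹ (z - s)` and `0` is too.
  have hpow : ∀ n, ∀ a ∈ 𝒜, Ψ (circleCoe ^ (n + 1)) a = 0 := by
    intro n a ha
    have h1 : circleCoe ^ (n + 1) = w (n + 2) - (s : ℂ) • w (n + 1) := by
      ext z
      have := circle_sub_ne_zero hs z
      simp [w]
      field_simp
      ring
    rw [h1, map_sub, map_smul, sub_apply, smul_apply,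
      hΨw _ _ ha, hΨw _ _ ha]
    simp
    ring
  refine ⟨fun l => Ψ (circleKernel l), Ψ.differentiable.comp_differentiableOn
    differentiableOn_circleKernel, ?_, ?_⟩
  · intro l hl a ha
    have hl : ‖l‖ < 1 := by simpa using hl
    have hstar : Ψ (star (circleKernel l)) a = Ψ 1 a := by
      have h1 := (((hasSum_star_circleKernel hl).mapL Ψ).mapL
        (ContinuousLinearMap.apply ℂ ℂ a))
      have h2 := hasSum_single (f := fun n : ℕ =>
        ContinuousLinearMap.apply ℂ ℂ a (Ψ ((conj l ^ n) • circleCoe ^ n))) 0 (by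
          intro n hn
          obtain ⟨m, rfl⟩ := Nat.exists_eq_succ_of_ne_zero hn
          have := hpow m a ha
          simp [this])
      have h3 := h1.unique h2
      simpa using h3
    -- The conjugate kernel acts as the constant `1`, so the Cauchy kernel may be replaced by the
    -- Poisson kernel, which is nonnegative with mean `1`: this is what yields the norm bound `r⁻¹`.
    have h1 : Ψ (circleKernel l) a = Ψ (circleKernel l + star (circleKernel l) - 1) a := by
      simp [hstar]
    change ‖Ψ (circleKernel l) a‖ ≤ _
    rw [h1, hΨ]
    refine (hLN _).trans ?_
    rw [hN, circleSeminorm_apply]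
    refine mul_le_mul_of_nonneg_left ?_ (by positivity)
    have h2 : ∀ z : Circle, ‖circleTensor (circleKernel l + star (circleKernel l) - 1) a z‖ =
        ‖a‖ * poissonKernel 0 l z := by
      intro z
      have hz := circle_sub_ne_zero hl z
      rw [circleTensor_apply, norm_smul, mul_comm]
      congr 1
      rw [circleKernel_add_star hl, Complex.norm_real,
        Real.norm_of_nonneg (poissonKernel_nonneg hl z)]
    simp only [h2]
    rw [circleMean_const_mul, circleMean_poissonKernel hl, mul_one]
  · intro a ha
    constructor
    · have h1 : circleKernel 0 = w 1 - (s : ℂ) • w 0 := by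
        ext z
        have := circle_sub_ne_zero hs z
        have := z.coe_ne_zero
        rw [circleKernel_apply (by simp)]
        simp [w]
        field_simp
      change Ψ (circleKernel 0) a = _
      rw [h1, map_sub, map_smul, sub_apply, smul_apply,
        hΨw _ _ ha, hΨw _ _ ha]
      simp
      field_simp
      ring
    · have h1 : circleKernel s = w 1 := by
        ext z
        rw [circleKernel_apply hs]
        simp [w]
      change Ψ (circleKernel s) a = _
      rw [h1, hΨw _ _ ha]
      simp
      field_simp

/-! ### Slices of functions on a product -/

section

variable {E F : Type*}

open Classical in
/-- The slices of a function of two variables that is bounded by `1` on `X × Y`. -/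
noncomputable def sliceFun (X : Set E) (Y : Set F) (f : E × F → ℂ) (x : E) : BddFun Y :=
  -- The value `0` only makes the slice a total function of `x`; it plays no role on `X` when `f` is
  -- bounded by `1`.
  if h : x ∈ X ∧ ∀ z ∈ X ×ˢ Y, ‖f z‖ ≤ 1 then
    ⟨fun y => f (x, y), memℓp_infty ⟨1, by
      rintro _ ⟨y, rfl⟩
      exact h.2 _ ⟨h.1, y.2⟩⟩⟩ else 0

variable {X : Set E} {Y : Set F} {f : E × F → ℂ}

theorem sliceFun_apply (hf : ∀ z ∈ X ×ˢ Y, ‖f z‖ ≤ 1) {x : E} (hx : x ∈ X) (y : Y) :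
    sliceFun X Y f x y = f (x, y) := by
  rw [sliceFun, dif_pos ⟨hx, hf⟩]

theorem norm_sliceFun_le (hf : ∀ z ∈ X ×ˢ Y, ‖f z‖ ≤ 1) {x : E} (hx : x ∈ X) :
    ‖sliceFun X Y f x‖ ≤ 1 := by
  refine lp.norm_le_of_forall_le zero_le_one fun y => ?_
  rw [sliceFun_apply hf hx]
  exact hf _ ⟨hx, y.2⟩

end

section

variable {E F : Type*} [NormedAddCommGroup E] [NormedSpace ℂ E] [NormedAddCommGroup F]
  [NormedSpace ℂ F]

/-- The constants depend on the radius alone. Applied to all slices at once they give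
differentiability in the supremum norm. -/
theorem norm_fderiv_and_taylor_le {f : E → ℂ} {x₀ : E} {R : ℝ} (hR : 0 < R)
    (hf : DifferentiableOn ℂ f (ball x₀ R)) (hb : ∀ x ∈ ball x₀ R, ‖f x‖ ≤ 1) :
    ‖fderiv ℂ f x₀‖ ≤ 2 / R ∧
      ∀ x ∈ ball x₀ R, ‖f x - f x₀ - fderiv ℂ f x₀ (x - x₀)‖ ≤ 4 * (‖x - x₀‖ / R) ^ 2 := by
  have hx₀ : x₀ ∈ ball x₀ R := mem_ball_self hR
  have h2 : ∀ x ∈ ball x₀ R, ‖f x - f x₀‖ ≤ 2 := fun x hx =>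
    (norm_sub_le _ _).trans (by linarith [hb x hx, hb x₀ hx₀])
  have h1 : ‖fderiv ℂ f x₀‖ ≤ 2 / R := norm_fderiv_le_div_of_mapsTo_ball hf
    (fun x hx => by rw [mem_closedBall_iff_norm]; exact h2 x hx) hR
  refine ⟨h1, fun x hx => ?_⟩
  set D := fderiv ℂ f x₀
  have hd : HasFDerivAt f D x₀ := (hf.differentiableAt (isOpen_ball.mem_nhds hx₀)).hasFDerivAt
  -- Removing the linear part leaves an increment bounded by `2 + 2 = 4` that vanishes to second
  -- order, so the higher-order Schwarz lemma gives the quadratic bound.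
  have := dist_le_mul_div_pow_of_mapsTo_ball_of_isLittleO (f := fun x => f x - D (x - x₀)) (n := 1)
    (c := x₀) (R₁ := R) (R₂ := 4) (z := x) (hf.sub (by fun_prop)) (fun y hy => by
      rw [mem_closedBall_iff_norm]
      simp only [sub_self, map_zero, sub_zero]
      have h3 : ‖D (y - x₀)‖ ≤ 2 := by
        refine (D.le_opNorm _).trans ?_
        have h4 : ‖y - x₀‖ ≤ R := (mem_ball_iff_norm.1 hy).le
        calc ‖D‖ * ‖y - x₀‖ ≤ 2 / R * R := by gcongr
          _ = 2 := by field_simp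
      calc ‖f y - D (y - x₀) - f x₀‖ = ‖(f y - f x₀) - D (y - x₀)‖ := by congr 1; ring
        _ ≤ ‖f y - f x₀‖ + ‖D (y - x₀)‖ := norm_sub_le _ _
        _ ≤ 4 := by linarith [h2 y hy]) (by
      have h5 := hd.isLittleO.norm_right
      simp only [sub_self, map_zero, sub_zero, pow_one]
      refine h5.congr_left fun y => by ring) hx
  simp only [sub_self, map_zero, sub_zero] at this
  rw [dist_eq_norm, dist_eq_norm] at this
  refine le_trans (le_of_eq ?_) this
  congr 1; ring

variable {X : Set E} {Y : Set F} {f : E × F → ℂ}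

theorem sliceFun_mem (hf : ∀ z ∈ X ×ˢ Y, ‖f z‖ ≤ 1) (hd : DifferentiableOn ℂ f (X ×ˢ Y))
    {x : E} (hx : x ∈ X) : sliceFun X Y f x ∈ boundedHolomorphic Y :=
  ⟨fun y => f (x, y), hd.comp (by fun_prop) fun _ hy => ⟨hx, hy⟩, fun y => sliceFun_apply hf hx y⟩

theorem differentiableOn_sliceFun (hX : IsOpen X) (hf : ∀ z ∈ X ×ˢ Y, ‖f z‖ ≤ 1)
    (hd : DifferentiableOn ℂ f (X ×ˢ Y)) : DifferentiableOn ℂ (sliceFun X Y f) X := by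
  intro x₀ hx₀
  obtain ⟨R, hR, hRX⟩ := Metric.isOpen_iff.1 hX x₀ hx₀
  have hy : ∀ y : Y, DifferentiableOn ℂ (fun x => f (x, y)) (ball x₀ R) := fun y =>
    hd.comp (by fun_prop) fun x hx => ⟨hRX hx, y.2⟩
  have hT := fun y : Y => norm_fderiv_and_taylor_le hR (hy y)
    fun x hx => hf (x, y) ⟨hRX hx, y.2⟩
  let D : E →L[ℂ] BddFun Y := LinearMap.mkContinuous
    { toFun := fun h => ⟨fun y => fderiv ℂ (fun x => f (x, (y : F))) x₀ h,
        memℓp_infty ⟨2 / R * ‖h‖, by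
          rintro _ ⟨y, rfl⟩
          exact ContinuousLinearMap.le_of_opNorm_le _ (hT y).1 h⟩⟩
      map_add' := fun h h' => Subtype.ext (funext fun y => map_add _ h h')
      map_smul' := fun k h => Subtype.ext (funext fun y => map_smul _ k h) } (2 / R) fun h =>
        lp.norm_le_of_forall_le (by positivity) fun y =>
          ContinuousLinearMap.le_of_opNorm_le _ (hT y).1 h
  have hD : ∀ h y, D h y = fderiv ℂ (fun x => f (x, (y : F))) x₀ h := fun _ _ => rfl
  have hder : HasFDerivAt (sliceFun X Y f) D x₀ := by
    rw [hasFDerivAt_iff_isLittleO]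
    have hO : (fun x => sliceFun X Y f x - sliceFun X Y f x₀ - D (x - x₀)) =O[𝓝 x₀]
        fun x => ‖x - x₀‖ ^ 2 := by
      refine Asymptotics.IsBigO.of_bound (4 / R ^ 2) ?_
      filter_upwards [isOpen_ball.mem_nhds (mem_ball_self hR)] with x hx
      rw [Real.norm_of_nonneg (by positivity)]
      refine lp.norm_le_of_forall_le (by positivity) fun y => ?_
      have := (hT y).2 x hx
      rw [lp.coeFn_sub, Pi.sub_apply, lp.coeFn_sub, Pi.sub_apply, sliceFun_apply hf (hRX hx),
        sliceFun_apply hf hx₀, hD]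
      refine this.trans (le_of_eq ?_)
      rw [div_pow]; ring
    refine hO.trans_isLittleO ?_
    have h1 : Filter.Tendsto (fun x => ‖x - x₀‖) (𝓝 x₀) (𝓝 0) := by
      have : Continuous fun x => ‖x - x₀‖ := by fun_prop
      simpa using this.tendsto x₀
    have h2 := (Asymptotics.isLittleO_one_iff ℝ).2 h1 |>.mul_isBigO
      (Asymptotics.isBigO_refl (fun x => ‖x - x₀‖) (𝓝 x₀))
    simp only [one_mul] at h2
    refine (h2.congr_left fun x => (sq _).symm).of_norm_right
  exact hder.differentiableAt.differentiableWithinAt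

/-! ### The product property for two factors -/

theorem TwoPointBound.mono_dist {p q : F} {c c' : ℝ} (h : TwoPointBound Y p q c) (hc : c ≤ c') :
    TwoPointBound Y p q c' := fun f hf hb =>
  (h f hf hb).trans (mul_le_mul_of_nonneg_right hc (norm_nonneg _))

/-- There are holomorphic functions from `Y` to the disk that spread `p` and `q` apart by any
pseudo-hyperbolic distance less than `c`. -/
def TwoPointSpread (Y : Set F) (p q : F) (c : ℝ) : Prop :=
  ∀ s : ℝ, 0 < s → s < c → ∃ γ : F → ℂ, DifferentiableOn ℂ γ Y ∧ (∀ y ∈ Y, ‖γ y‖ < 1) ∧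
    γ p = 0 ∧ γ q = s

/-- The factor with the larger distance supplies the parameter `g` and the final bound; the other
one is averaged out by the family of functionals. The assumption `c' ≤ c` lets one `s` be reached in
both factors. -/
theorem TwoPointBound.prod_of_le {p q : E} {p' q' : F} {c c' : ℝ} (hX : IsOpen X)
    (hp : p ∈ X) (hq : q ∈ X) (hp' : p' ∈ Y) (hq' : q' ∈ Y)
    (hbX : TwoPointBound X p q c) (hsX : TwoPointSpread X p q c)
    (hbY : TwoPointBound Y p' q' c') (hsY : TwoPointSpread Y p' q' c')
    (hc' : 0 ≤ c') (hcc : c' ≤ c) : TwoPointBound (X ×ˢ Y) (p, p') (q, q') c := by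
  intro f hd hf
  -- If `c' = 0`, slices in `Y` do not separate `p'` from `q'`, and no positive `s` is available.
  rcases hc'.eq_or_lt with rfl | hpos
  · have h1 := hbY (fun y => f (q, y)) (hd.comp (by fun_prop) fun _ hy => ⟨hq, hy⟩)
      fun y hy => hf _ ⟨hq, hy⟩
    rw [zero_mul, norm_le_zero_iff, sub_eq_zero] at h1
    have h2 := hbX (fun x => f (x, p')) (hd.comp (by fun_prop) fun _ hx => ⟨hx, hp'⟩)
      fun x hx => hf _ ⟨hx, hp'⟩
    rwa [h1]
  have step : ∀ r ∈ Ioo (0 : ℝ) 1, ‖r * f (q, q') - r * f (p, p')‖ ≤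
      c * ‖1 - conj (r * f (p, p')) * (r * f (q, q'))‖ := by
    rintro r ⟨hr0, hr1⟩
    have hr2 : 2 * r / (1 + r ^ 2) < 1 := by
      rw [div_lt_one (by positivity)]; nlinarith [mul_pos (sub_pos.2 hr1) (sub_pos.2 hr1)]
    have hs0 : 0 < 2 * r / (1 + r ^ 2) * c' := by positivity
    have hsc : 2 * r / (1 + r ^ 2) * c' < c' := by nlinarith
    -- This `s` is strictly below `c'`, hence attainable by spreading functions, and it is the
    -- distance left after shrinking by `r`.
    set s := 2 * r / (1 + r ^ 2) * c' with hs
    obtain ⟨γ, hγ, hγ1, hγp, hγq⟩ := hsY s hs0 hsc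
    obtain ⟨g, hg, hg1, hgp, hgq⟩ := hsX s hs0 (hsc.trans_le hcc)
    have hs1 : s < 1 := by
      have := hg1 q hq
      rwa [hgq, Complex.norm_real, Real.norm_of_nonneg hs0.le] at this
    let ev (y : Y) : BddFun Y →ₗ[ℂ] ℂ :=
      { toFun := fun a => a y, map_add' := fun _ _ => rfl, map_smul' := fun _ _ => rfl }
    obtain ⟨φ, hφd, hφb, hφ⟩ := exists_holomorphic_family_of_bound (𝒜 := boundedHolomorphic Y)
      (e₀ := ev ⟨p', hp'⟩) (e₁ := ev ⟨q', hq'⟩) hs0 hs1 hr0 fun g =>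
        norm_polyValue_sub_le (p := ⟨p', hp'⟩) (q := ⟨q', hq'⟩) hbY hc' hγ
          (fun y hy => (hγ1 y hy).le) hγp hγq hs0 hs1 hr0 hr1 hs.ge g
    have h := hbX (fun x => r * φ (g x) (sliceFun X Y f x)) ?_ ?_
    · simp only [hgp, hgq, (hφ _ (sliceFun_mem hf hd hp)).1, (hφ _ (sliceFun_mem hf hd hq)).2] at h
      have e1 : ev ⟨p', hp'⟩ (sliceFun X Y f p) = f (p, p') := sliceFun_apply hf hp ⟨p', hp'⟩
      have e2 : ev ⟨q', hq'⟩ (sliceFun X Y f q) = f (q, q') := sliceFun_apply hf hq ⟨q', hq'⟩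
      rwa [e1, e2] at h
    · refine DifferentiableOn.const_mul ?_ _
      exact (hφd.comp hg fun x hx => by simpa using hg1 x hx).clm_apply
        (differentiableOn_sliceFun hX hf hd)
    · intro x hx
      have h1 := hφb (g x) (by simpa using hg1 x hx) _ (sliceFun_mem hf hd hx)
      rw [norm_mul, Complex.norm_real, Real.norm_of_nonneg hr0.le]
      calc r * ‖φ (g x) (sliceFun X Y f x)‖ ≤ r * (r⁻¹ * ‖sliceFun X Y f x‖) := by gcongr
        _ ≤ r * (r⁻¹ * 1) := by gcongr; exact norm_sliceFun_le hf hx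
        _ = 1 := by field_simp
  have hcont1 : Continuous fun r : ℝ => ‖r * f (q, q') - r * f (p, p')‖ := by fun_prop
  have hcont2 : Continuous fun r : ℝ => c * ‖1 - conj (r * f (p, p')) * (r * f (q, q'))‖ := by
    fun_prop
  have := le_of_tendsto_of_tendsto (hcont1.tendsto 1 |>.mono_left nhdsWithin_le_nhds)
    (hcont2.tendsto 1 |>.mono_left nhdsWithin_le_nhds)
    (b := 𝓝[<] (1 : ℝ)) (by
      filter_upwards [Ioo_mem_nhdsLT zero_lt_one] with r hr using step r hr)
  simpa using this

theorem TwoPointBound.prod {p q : E} {p' q' : F} {c c' : ℝ} (hX : IsOpen X) (hY : IsOpen Y)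
    (hp : p ∈ X) (hq : q ∈ X) (hp' : p' ∈ Y) (hq' : q' ∈ Y)
    (hbX : TwoPointBound X p q c) (hsX : TwoPointSpread X p q c)
    (hbY : TwoPointBound Y p' q' c') (hsY : TwoPointSpread Y p' q' c')
    (hc : 0 ≤ c) (hc' : 0 ≤ c') : TwoPointBound (X ×ˢ Y) (p, p') (q, q') (max c c') := by
  rcases le_total c' c with h | h
  · rw [max_eq_left h]
    exact TwoPointBound.prod_of_le hX hp hq hp' hq' hbX hsX hbY hsY hc' h
  · rw [max_eq_right h]
    have := TwoPointBound.prod_of_le hY hp' hq' hp hq hbY hsY hbX hsX hc h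
    intro f hd hf
    exact this (fun z => f z.swap)
      (hd.comp (f := Prod.swap) (differentiable_snd.prodMk differentiable_fst).differentiableOn
        fun z hz => ⟨hz.2, hz.1⟩)
      fun z hz => hf _ ⟨hz.2, hz.1⟩

end

/-! ### The Möbius pseudo-distance as a two-point constant -/

theorem one_sub_conj_mul_ne_zero {a b : ℂ} (ha : ‖a‖ < 1) (hb : ‖b‖ < 1) :
    1 - conj a * b ≠ 0 := by
  have := one_add_conj_mul_ne_zero (a := a) (w := -b) ha (by simpa using hb.le)
  simpa [sub_eq_add_neg] using this

theorem pseudoHyperbolicDist_le_one {a b : ℂ} (ha : ‖a‖ < 1) (hb : ‖b‖ < 1) :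
    pseudoHyperbolicDist a b ≤ 1 := by
  have h := norm_add_div_le_one (a := -b) (w := a) (by simpa using hb) ha.le
  rw [pseudoHyperbolicDist]
  refine le_trans (le_of_eq ?_) h
  congr 2
  · ring
  · simp [sub_eq_add_neg]

section

variable {ι : Type*} {Ω : Set (ι → ℂ)} {p q : ι → ℂ}

theorem moebiusDist_bddAbove (hp : p ∈ Ω) (hq : q ∈ Ω) :
    BddAbove {x : ℝ | ∃ f : (ι → ℂ) → ℂ, DifferentiableOn ℂ f Ω ∧ (∀ ζ ∈ Ω, ‖f ζ‖ < 1) ∧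
      x = pseudoHyperbolicDist (f q) (f p)} :=
  ⟨1, by
    rintro _ ⟨f, -, hf, rfl⟩
    exact pseudoHyperbolicDist_le_one (hf q hq) (hf p hp)⟩

variable [Fintype ι]

theorem le_moebiusDist (hp : p ∈ Ω) (hq : q ∈ Ω) {f : (ι → ℂ) → ℂ} (hd : DifferentiableOn ℂ f Ω)
    (hf : ∀ z ∈ Ω, ‖f z‖ < 1) : pseudoHyperbolicDist (f q) (f p) ≤ moebiusDist Ω q p :=
  le_csSup (moebiusDist_bddAbove hp hq) ⟨f, hd, hf, rfl⟩

theorem moebiusDist_nonneg (hp : p ∈ Ω) (hq : q ∈ Ω) : 0 ≤ moebiusDist Ω q p :=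
  (norm_nonneg _).trans (le_moebiusDist hp hq (f := fun _ => 0) (by fun_prop) (by simp))

/-- Functions into the closed disk are reached from those into the open disk by scaling with `r < 1`
and letting `r → 1`. -/
theorem twoPointBound_moebiusDist (hp : p ∈ Ω) (hq : q ∈ Ω) :
    TwoPointBound Ω p q (moebiusDist Ω q p) := by
  intro f hd hf
  have step : ∀ r ∈ Ioo (0 : ℝ) 1, ‖r * f q - r * f p‖ ≤
      moebiusDist Ω q p * ‖1 - conj (r * f p) * (r * f q)‖ := by
    rintro r ⟨hr0, hr1⟩
    have hlt : ∀ z ∈ Ω, ‖r * f z‖ < 1 := fun z hz => by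
      rw [norm_mul, Complex.norm_real, Real.norm_of_nonneg hr0.le]
      nlinarith [hf z hz, norm_nonneg (f z)]
    have h := le_moebiusDist hp hq (hd.const_mul (r : ℂ)) hlt
    rwa [pseudoHyperbolicDist, norm_div, div_le_iff₀
      (norm_pos_iff.2 (one_sub_conj_mul_ne_zero (hlt p hp) (hlt q hq)))] at h
  have hcont1 : Continuous fun r : ℝ => ‖r * f q - r * f p‖ := by fun_prop
  have hcont2 : Continuous fun r : ℝ =>
      moebiusDist Ω q p * ‖1 - conj (r * f p) * (r * f q)‖ := by
    fun_prop
  have := le_of_tendsto_of_tendsto (hcont1.tendsto 1 |>.mono_left nhdsWithin_le_nhds)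
    (hcont2.tendsto 1 |>.mono_left nhdsWithin_le_nhds)
    (b := 𝓝[<] (1 : ℝ)) (by
      filter_upwards [Ioo_mem_nhdsLT zero_lt_one] with r hr using step r hr)
  simpa using this

/-- Take a nearly extremal `f`, move `f p` to `0` by a disk automorphism, then multiply by a
constant of modulus below `1` so that the value at `q` becomes exactly `s`. -/
theorem twoPointSpread_moebiusDist (hp : p ∈ Ω) :
    TwoPointSpread Ω p q (moebiusDist Ω q p) := by
  intro s hs0 hs
  obtain ⟨_, ⟨f, hd, hf, rfl⟩, hsf⟩ := exists_lt_of_lt_csSup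
    (by exact ⟨_, fun _ => 0, by fun_prop, by simp, rfl⟩) hs
  set m : (ι → ℂ) → ℂ := fun z => (f z - f p) / (1 - conj (f p) * f z) with hm
  have hmq : s < ‖m q‖ := hsf
  have hmd : DifferentiableOn ℂ m Ω := by
    simp only [hm, div_eq_mul_inv]
    exact (hd.sub_const _).mul (((hd.const_mul _).const_sub 1).inv fun z hz =>
      one_sub_conj_mul_ne_zero (hf p hp) (hf z hz))
  have hm1 : ∀ z ∈ Ω, ‖m z‖ ≤ 1 := fun z hz => pseudoHyperbolicDist_le_one (hf z hz) (hf p hp)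
  have hne : m q ≠ 0 := norm_pos_iff.1 (hs0.trans hmq)
  refine ⟨fun z => s / m q * m z, hmd.const_mul _, fun z hz => ?_, by simp [hm], ?_⟩
  · rw [norm_mul, norm_div, Complex.norm_real, Real.norm_of_nonneg hs0.le]
    have h1 : s / ‖m q‖ < 1 := (div_lt_one (hs0.trans hmq)).2 hmq
    have h2 : 0 < s / ‖m q‖ := div_pos hs0 (hs0.trans hmq)
    nlinarith [hm1 z hz, norm_nonneg (m z)]
  · simp only
    field_simp

theorem moebiusDist_le (hp : p ∈ Ω) (hq : q ∈ Ω) {c : ℝ} (h : TwoPointBound Ω p q c) :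
    moebiusDist Ω q p ≤ c := by
  refine csSup_le ⟨_, fun _ => 0, by fun_prop, by simp, rfl⟩ ?_
  rintro _ ⟨f, hd, hf, rfl⟩
  rw [pseudoHyperbolicDist, norm_div, div_le_iff₀
    (norm_pos_iff.2 (one_sub_conj_mul_ne_zero (hf p hp) (hf q hq)))]
  exact h f hd fun z hz => (hf z hz).le

end

/-! ### Products of finitely many domains -/

section

variable {d : ℕ} {n : Fin d → ℕ}

/-- Replace the `r`-th block of a vector. -/
def blockUpdate (r : Fin d) (z : ((Σ r, Fin (n r)) → ℂ) × (Fin (n r) → ℂ)) :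
    (Σ r, Fin (n r)) → ℂ :=
  fun k => if h : k.1 = r then z.2 (h ▸ k.2) else z.1 k

theorem differentiable_blockUpdate (r : Fin d) : Differentiable ℂ (blockUpdate (n := n) r) := by
  rw [differentiable_pi]
  rintro ⟨k, i⟩
  by_cases h : k = r
  · subst h
    simp only [blockUpdate, dite_true]
    fun_prop
  · simp only [blockUpdate, h, dite_false]
    fun_prop

theorem tupleBlock_blockUpdate (r : Fin d)
    (z : ((Σ r, Fin (n r)) → ℂ) × (Fin (n r) → ℂ)) (k : Fin d) :
    tupleBlock (blockUpdate r z) k = if h : k = r then h ▸ z.2 else tupleBlock z.1 k := by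
  ext i
  by_cases h : k = r
  · subst h; simp [tupleBlock, blockUpdate]
  · simp [tupleBlock, blockUpdate, h]

theorem isOpen_blockProd {B : ∀ r, Set (Fin (n r) → ℂ)} (hB : ∀ r, IsOpen (B r)) :
    IsOpen (blockProd B) := by
  have : blockProd B = ⋂ r, (fun z => tupleBlock z r) ⁻¹' B r := by
    ext z; simp [blockProd]
  rw [this]
  refine isOpen_iInter_of_finite fun r => (hB r).preimage ?_
  exact continuous_pi fun i => continuous_apply _

open Classical in
/-- The Möbius pseudo-distance has the product property. -/
theorem moebiusDist_blockProd_le {B : ∀ r, Set (Fin (n r) → ℂ)} (hB : ∀ r, IsOpen (B r))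
    {p q : (Σ r, Fin (n r)) → ℂ} (hp : p ∈ blockProd B) (hq : q ∈ blockProd B) {c : ℝ}
    (hc : 0 ≤ c) (h : ∀ r, moebiusDist (B r) (tupleBlock q r) (tupleBlock p r) ≤ c) :
    moebiusDist (blockProd B) q p ≤ c := by
  -- These points pass from `p` to `q` one block at a time.
  let qS (S : Finset (Fin d)) : (Σ r, Fin (n r)) → ℂ := fun k => if k.1 ∈ S then q k else p k
  have hqS : ∀ S, qS S ∈ blockProd B := by
    intro S r
    by_cases hr : r ∈ S
    · have : tupleBlock (qS S) r = tupleBlock q r := by ext i; simp [tupleBlock, qS, hr]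
      rw [this]; exact hq r
    · have : tupleBlock (qS S) r = tupleBlock p r := by ext i; simp [tupleBlock, qS, hr]
      rw [this]; exact hp r
  have main : ∀ S, moebiusDist (blockProd B) (qS S) p ≤ c := by
    intro S
    induction S using Finset.induction_on with
    | empty =>
      refine moebiusDist_le hp (hqS _) fun f _ _ => ?_
      have : qS ∅ = p := by ext k; simp [qS]
      rw [this, sub_self, norm_zero]
      positivity
    | insert r S hr ih =>
      -- The whole product serves as the first factor and `B r` as the second; pulling `f` back
      -- along `blockUpdate r` makes this legitimate without splitting off the block.
      have htwo := TwoPointBound.prod (isOpen_blockProd hB) (hB r) hp (hqS S) (hp r) (hq r)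
        (twoPointBound_moebiusDist hp (hqS S)) (twoPointSpread_moebiusDist hp)
        (twoPointBound_moebiusDist (hp r) (hq r)) (twoPointSpread_moebiusDist (hp r))
        (moebiusDist_nonneg hp (hqS S)) (moebiusDist_nonneg (hp r) (hq r))
      refine moebiusDist_le hp (hqS _) fun f hd hf => ?_
      have hmaps : ∀ z ∈ blockProd B ×ˢ B r, blockUpdate r z ∈ blockProd B := by
        intro z hz k
        rw [tupleBlock_blockUpdate]
        split_ifs with hk
        · subst hk; exact hz.2
        · exact hz.1 k
      have := (htwo.mono_dist (max_le ih (h r))) (fun z => f (blockUpdate r z))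
        (hd.comp (differentiable_blockUpdate r).differentiableOn hmaps)
        fun z hz => hf _ (hmaps z hz)
      have e1 : blockUpdate r (p, tupleBlock p r) = p := by
        ext ⟨k, i⟩
        by_cases hk : k = r
        · subst hk; simp [blockUpdate, tupleBlock]
        · simp [blockUpdate, hk]
      have e2 : blockUpdate r (qS S, tupleBlock q r) = qS (insert r S) := by
        ext ⟨k, i⟩
        by_cases hk : k = r
        · subst hk; simp [blockUpdate, tupleBlock, qS]
        · simp [blockUpdate, hk, qS]
      simpa only [e1, e2] using this
  have hu : qS Finset.univ = q := by ext k; simp [qS]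
  rw [← hu]
  exact main _

end

end MoebiusDistance

/-! ### Matrix-valued Schwarz–Pick and the spectral estimate -/

section SpectralDomain

section

variable {ι m l k : Type*} [Fintype ι] {Ω : Set (ι → ℂ)}

theorem IsHolomorphicMatrixOn.mul [Fintype l] {F : (ι → ℂ) → Matrix m l ℂ}
    {G : (ι → ℂ) → Matrix l k ℂ} (hF : IsHolomorphicMatrixOn F Ω) (hG : IsHolomorphicMatrixOn G Ω) :
    IsHolomorphicMatrixOn (fun z => F z * G z) Ω := fun i j => by
  simp only [Matrix.mul_apply]
  exact DifferentiableOn.fun_sum fun p _ => (hF i p).mul (hG p j)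

theorem isHolomorphicMatrixOn_const (A : Matrix m l ℂ) :
    IsHolomorphicMatrixOn (fun _ => A) Ω := fun _ _ => differentiableOn_const _

theorem IsHolomorphicMatrixOn.sub {F G : (ι → ℂ) → Matrix m l ℂ}
    (hF : IsHolomorphicMatrixOn F Ω) (hG : IsHolomorphicMatrixOn G Ω) :
    IsHolomorphicMatrixOn (fun z => F z - G z) Ω := fun i j => (hF i j).sub (hG i j)

theorem IsHolomorphicMatrixOn.differentiableOn [Fintype m] [Fintype l] [DecidableEq m]
    [DecidableEq l] {F : (ι → ℂ) → Matrix m l ℂ} (hF : IsHolomorphicMatrixOn F Ω) :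
    DifferentiableOn ℂ F Ω := by
  have h : F = fun z => ∑ i, ∑ j, F z i j • Matrix.single i j (1 : ℂ) := by
    funext z
    conv_lhs => rw [Matrix.matrix_eq_sum_single (F z)]
    simp [Matrix.smul_single]
  rw [h]
  exact DifferentiableOn.fun_sum fun i _ => DifferentiableOn.fun_sum fun j _ =>
    (hF i j).smul_const _

theorem IsHolomorphicMatrixOn.inv [Fintype l] [DecidableEq l] {F : (ι → ℂ) → Matrix l l ℂ}
    (hF : IsHolomorphicMatrixOn F Ω) (hu : ∀ z ∈ Ω, IsUnit (F z)) :
    IsHolomorphicMatrixOn (fun z => (F z)⁻¹) Ω := fun i j => by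
  have h1 : DifferentiableOn ℂ (fun z => Ring.inverse (F z)) Ω :=
    hF.differentiableOn.inverse hu
  let L := (Matrix.entryLinearMap ℂ ℂ i j : Matrix l l ℂ →ₗ[ℂ] ℂ).toContinuousLinearMap
  have h2 := L.differentiable.comp_differentiableOn h1
  refine h2.congr fun z _ => ?_
  change (F z)⁻¹ i j = Ring.inverse (F z) i j
  rw [Matrix.nonsing_inv_eq_ringInverse]

/-- Pairing the Möbius transform with fixed vectors gives scalar functions into the closed disk
vanishing at `w`; for these the two-point bound is the Schwarz lemma. -/
theorem norm_matrixMoebius_le_moebiusDist [Fintype m] [Fintype l] [DecidableEq m] [DecidableEq l]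
    {f : (ι → ℂ) → Matrix m l ℂ} (hf : IsHolomorphicMatrixOn f Ω) (hf1 : ∀ z ∈ Ω, ‖f z‖ < 1)
    {z w : ι → ℂ} (hz : z ∈ Ω) (hw : w ∈ Ω) :
    ‖matrixMoebius (f w) (f z)‖ ≤ moebiusDist Ω z w := by
  have hM : IsHolomorphicMatrixOn (fun ζ => matrixMoebius (f w) (f ζ)) Ω := by
    unfold matrixMoebius
    refine ((((isHolomorphicMatrixOn_const _).mul (hf.sub (isHolomorphicMatrixOn_const _))).mul
      (IsHolomorphicMatrixOn.inv ((isHolomorphicMatrixOn_const _).sub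
        ((isHolomorphicMatrixOn_const _).mul hf)) fun ζ hζ => ?_)).mul
          (isHolomorphicMatrixOn_const _))
    exact isUnit_one_sub_conjTranspose_mul (hf1 w hw) (hf1 ζ hζ)
  refine matrix_norm_le_of_dotProduct _ (moebiusDist_nonneg hw hz) fun u x => ?_
  let φ : (ι → ℂ) → ℂ := fun ζ =>
    (star u.ofLp ⬝ᵥ (matrixMoebius (f w) (f ζ) *ᵥ x.ofLp)) * ((‖u‖ * ‖x‖ : ℝ) : ℂ)⁻¹
  have hφd : DifferentiableOn ℂ φ Ω := by
    refine DifferentiableOn.mul_const ?_ _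
    simp only [dotProduct, Matrix.mulVec]
    exact DifferentiableOn.fun_sum fun i _ => DifferentiableOn.const_mul
      (DifferentiableOn.fun_sum fun j _ => (hM i j).mul_const _) _
  have hφn : ∀ ζ, ‖φ ζ‖ = ‖star u.ofLp ⬝ᵥ (matrixMoebius (f w) (f ζ) *ᵥ x.ofLp)‖ /
      (‖u‖ * ‖x‖) := fun ζ => by
    rw [norm_mul, norm_inv, Complex.norm_real, Real.norm_of_nonneg (by positivity), div_eq_mul_inv]
  have hφ1 : ∀ ζ ∈ Ω, ‖φ ζ‖ ≤ 1 := fun ζ hζ => by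
    rw [hφn]
    refine div_le_one_of_le₀ ((norm_dotProduct_mulVec_le _ u x).trans ?_) (by positivity)
    exact mul_le_of_le_one_left (by positivity) (norm_matrixMoebius_le_one (hf1 w hw) (hf1 ζ hζ))
  have h := twoPointBound_moebiusDist hw hz φ hφd hφ1
  have h0 : φ w = 0 := by simp [φ, matrixMoebius_self]
  rw [h0, sub_zero, map_zero, zero_mul, sub_zero, norm_one, mul_one, hφn] at h
  rcases (mul_nonneg (norm_nonneg u) (norm_nonneg x)).eq_or_lt with h2 | h2
  · refine (norm_dotProduct_mulVec_le _ u x).trans ?_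
    rw [← h2, mul_zero, mul_zero]
  · rwa [div_le_iff₀ h2] at h

theorem isOpen_matrixBall [Fintype m] [Fintype l] [DecidableEq m] [DecidableEq l]
    {f : (ι → ℂ) → Matrix m l ℂ} (hΩ : IsOpen Ω) (hf : IsHolomorphicMatrixOn f Ω) :
    IsOpen (matrixBall Ω f) :=
  hf.differentiableOn.continuousOn.norm.isOpen_inter_preimage hΩ isOpen_Iio

end

theorem matrix_norm_le_iff_sum {m l : Type*} [Fintype m] [Fintype l] [DecidableEq l]
    (M : Matrix m l ℂ) {c : ℝ} (hc : 0 ≤ c) :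
    ‖M‖ ≤ c ↔ ∀ x : l → ℂ, ∑ i, ‖(M *ᵥ x) i‖ ^ 2 ≤ c ^ 2 * ∑ j, ‖x j‖ ^ 2 := by
  have key : ∀ x : EuclideanSpace ℂ l, ‖WithLp.toLp 2 (M *ᵥ x.ofLp)‖ ≤ c * ‖x‖ ↔
      ∑ i, ‖(M *ᵥ x.ofLp) i‖ ^ 2 ≤ c ^ 2 * ∑ j, ‖x.ofLp j‖ ^ 2 := fun x => by
    rw [← sq_le_sq₀ (norm_nonneg _) (by positivity), mul_pow, EuclideanSpace.norm_sq_eq,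
      EuclideanSpace.norm_sq_eq]
  constructor
  · intro h x
    refine (key (WithLp.toLp 2 x)).1 ?_
    exact (Matrix.l2_opNorm_mulVec M (WithLp.toLp 2 x)).trans (by gcongr)
  · intro h
    rw [Matrix.l2_opNorm_def]
    exact ContinuousLinearMap.opNorm_le_bound _ hc fun x => (key x).2 (h _)

theorem norm_blockDiagonal'_lt_one_iff {d : ℕ} {s t : Fin d → ℕ}
    (M : ∀ r, Matrix (Fin (s r)) (Fin (t r)) ℂ) :
    ‖Matrix.blockDiagonal' M‖ < 1 ↔ ∀ r, ‖M r‖ < 1 := by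
  have hval : ∀ (x : (Σ r, Fin (t r)) → ℂ) r i,
      (Matrix.blockDiagonal' M *ᵥ x) ⟨r, i⟩ = (M r *ᵥ tupleBlock x r) i := by
    intro x r i
    simp only [Matrix.mulVec, dotProduct, Fintype.sum_sigma, tupleBlock]
    rw [Finset.sum_eq_single r]
    · simp [Matrix.blockDiagonal'_apply]
    · intro r' _ hr
      simp [Matrix.blockDiagonal'_apply, hr.symm]
    · simp
  constructor
  · intro h r
    refine lt_of_le_of_lt ((matrix_norm_le_iff_sum _ (norm_nonneg _)).2 fun x => ?_) h
    let y : (Σ r, Fin (t r)) → ℂ := fun k => if hk : k.1 = r then x (hk ▸ k.2) else 0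
    have hy : tupleBlock y r = x := by ext i; simp [y, tupleBlock]
    have h1 := (matrix_norm_le_iff_sum _ (norm_nonneg _)).1 (le_refl ‖Matrix.blockDiagonal' M‖) y
    have h2 : ∑ j, ‖y j‖ ^ 2 = ∑ j, ‖x j‖ ^ 2 := by
      rw [Fintype.sum_sigma, Finset.sum_eq_single r]
      · simp [y]
      · intro r' _ hr; simp [y, hr]
      · simp
    rw [h2, Fintype.sum_sigma] at h1
    simp only [hval] at h1
    refine le_trans ?_ h1
    have h3 := Finset.single_le_sum (f := fun r => ∑ i, ‖(M r *ᵥ tupleBlock y r) i‖ ^ 2)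
      (fun r _ => by positivity) (Finset.mem_univ r)
    simpa only [hy] using h3
  · intro h
    -- Finiteness of the index set gives one bound strictly below `1`; for `d = 0` it is `0`.
    obtain ⟨c, hc0, hc1, hc⟩ : ∃ c : ℝ, 0 ≤ c ∧ c < 1 ∧ ∀ r, ‖M r‖ ≤ c := by
      rcases isEmpty_or_nonempty (Fin d) with hd | hd
      · exact ⟨0, le_rfl, one_pos, fun r => hd.elim r⟩
      · obtain ⟨r, hr⟩ := Finite.exists_max fun r => ‖M r‖
        exact ⟨‖M r‖, norm_nonneg _, h r, hr⟩
    refine lt_of_le_of_lt ((matrix_norm_le_iff_sum _ hc0).2 fun x => ?_) hc1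
    rw [Fintype.sum_sigma, Fintype.sum_sigma, Finset.mul_sum]
    refine Finset.sum_le_sum fun r _ => ?_
    simp only [hval]
    exact (matrix_norm_le_iff_sum _ hc0).1 (hc r) _

theorem blockProd_matrixBall {d : ℕ} {n s t : Fin d → ℕ} (E : ∀ r, Set (Fin (n r) → ℂ))
    (Δ : ∀ r, (Fin (n r) → ℂ) → Matrix (Fin (s r)) (Fin (t r)) ℂ) :
    blockProd (fun r => matrixBall (E r) (Δ r)) =
      matrixBall (blockProd E) (matrixDirectSum Δ) := by
  ext z
  change (∀ r, tupleBlock z r ∈ E r ∧ ‖Δ r (tupleBlock z r)‖ < 1) ↔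
    (∀ r, tupleBlock z r ∈ E r) ∧ ‖Matrix.blockDiagonal' fun r => Δ r (tupleBlock z r)‖ < 1
  rw [norm_blockDiagonal'_lt_one_iff, forall_and]

theorem isConnected_blockProd {d : ℕ} {n : Fin d → ℕ} {B : ∀ r, Set (Fin (n r) → ℂ)}
    (hB : ∀ r, IsConnected (B r)) : IsConnected (blockProd B) := by
  have h : IsConnected (Set.univ.pi B) :=
    ⟨Set.univ_pi_nonempty_iff.2 fun r => (hB r).nonempty,
      isPreconnected_univ_pi fun r => (hB r).isPreconnected⟩
  have e : blockProd B = (fun (g : ∀ r, Fin (n r) → ℂ) (k : Σ r, Fin (n r)) => g k.1 k.2) ''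
      Set.univ.pi B := by
    ext z
    constructor
    · exact fun hz => ⟨fun r => tupleBlock z r, fun r _ => hz r, rfl⟩
    · rintro ⟨g, hg, rfl⟩ r
      exact hg r trivial
  rw [e]
  exact h.image _ (by fun_prop)

/-- After division by `c`, Schwarz–Pick gives the distance condition that is equivalent to
contractivity on the tensor eigenvectors. -/
theorem norm_tupleEval_le {ι κ : Type*} [Fintype ι] [Fintype κ] [DecidableEq κ]
    {Ω : Set (ι → ℂ)} {T : ι → Matrix (Fin 2) (Fin 2) ℂ} {v : Fin 2 → Fin 2 → ℂ}
    {z : Fin 2 → ι → ℂ} (hv : LinearIndependent ℂ v) (hT : ∀ j, IsJointEigenpair T (z j) (v j))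
    (hz : ∀ j, z j ∈ Ω) (hdist : moebiusDist Ω (z 1) (z 0) ≤ √(1 - cosSq v))
    {f : (ι → ℂ) → Matrix κ κ ℂ} (hf : IsHolomorphicMatrixOn f Ω) {c : ℝ} (hc : 0 < c)
    (hfc : ∀ ζ ∈ Ω, ‖f ζ‖ < c) : ‖tupleEval f T‖ ≤ c := by
  have hval := IsDiagonalizableTuple.isTupleValue_tupleEval ⟨v, z, hv, hT⟩ f
  have hc' : ((c⁻¹ : ℝ) : ℂ) ≠ 0 := by exact_mod_cast (inv_pos.2 hc).ne'
  have hnorm : ∀ {m l : Type _} [Fintype m] [Fintype l] [DecidableEq l] (X : Matrix m l ℂ),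
      ‖((c⁻¹ : ℝ) : ℂ) • X‖ = c⁻¹ * ‖X‖ := fun X => by
    rw [norm_smul, Complex.norm_real, Real.norm_of_nonneg (inv_pos.2 hc).le]
  have hg : IsHolomorphicMatrixOn (fun ζ => ((c⁻¹ : ℝ) : ℂ) • f ζ) Ω :=
    fun i j => (hf i j).const_mul _
  have hg1 : ∀ ζ ∈ Ω, ‖((c⁻¹ : ℝ) : ℂ) • f ζ‖ < 1 := fun ζ hζ => by
    rw [hnorm, inv_mul_lt_one₀ hc]
    exact hfc ζ hζ
  have htensor : ∀ (a : ℂ) (x : κ → ℂ) (u : Fin 2 → ℂ), a • tensorVec x u = tensorVec (a • x) u :=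
    fun a x u => by ext p; simp [tensorVec, mul_assoc]
  have hM : ∀ j x, (((c⁻¹ : ℝ) : ℂ) • tupleEval f T) *ᵥ tensorVec x (v j) =
      tensorVec ((((c⁻¹ : ℝ) : ℂ) • f (z j)) *ᵥ x) (v j) := fun j x => by
    rw [Matrix.smul_mulVec, hval _ _ (hv.ne_zero j) (hT j), htensor, Matrix.smul_mulVec]
  have h := (norm_le_one_iff_norm_matrixMoebius_le (hg1 _ (hz 0)) (hg1 _ (hz 1)) hv
    (hM 0) (hM 1)).2 ((norm_matrixMoebius_le_moebiusDist hg hg1 (hz 1) (hz 0)).trans hdist)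
  rwa [hnorm, inv_mul_le_one₀ hc] at h

end SpectralDomain

theorem corollary5p8 {d : ℕ} (n s t : Fin d → ℕ)
    (E : ∀ r, Set (Fin (n r) → ℂ))
    (Δ : ∀ r, (Fin (n r) → ℂ) → Matrix (Fin (s r)) (Fin (t r)) ℂ)
    (hE_open : ∀ r, IsOpen (E r)) (hE_conn : ∀ r, IsConnected (E r))
    (hΔ : ∀ r, IsHolomorphicMatrixOn (Δ r) (E r))
    (hB_conn : ∀ r, IsConnected (matrixBall (E r) (Δ r)))
    (hdist : ∀ r, ∀ z ∈ matrixBall (E r) (Δ r), ∀ w ∈ matrixBall (E r) (Δ r),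
      matrixDist (Δ r) z w = moebiusDist (matrixBall (E r) (Δ r)) z w) :
    blockProd (fun r => matrixBall (E r) (Δ r)) = matrixBall (blockProd E) (matrixDirectSum Δ) ∧
    ∀ T : (Σ r, Fin (n r)) → Matrix (Fin 2) (Fin 2) ℂ, IsDiagonalizableTuple T →
      (∀ r, jointSpectrum (tupleBlock T r) ⊆ matrixBall (E r) (Δ r)) →
      (∀ r, ‖tupleEval (Δ r) (tupleBlock T r)‖ ≤ 1) →
      IsCompleteSpectralDomain (blockProd fun r => matrixBall (E r) (Δ r)) T := by
  refine ⟨blockProd_matrixBall E Δ, fun T hT hspec hnorm => ?_⟩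
  have hopen : ∀ r, IsOpen (matrixBall (E r) (Δ r)) := fun r => isOpen_matrixBall (hE_open r) (hΔ r)
  have hsub : jointSpectrum T ⊆ blockProd fun r => matrixBall (E r) (Δ r) := by
    rintro a ⟨u, hu, hua⟩ r
    exact hspec r ⟨u, hu, fun i => hua ⟨r, i⟩⟩
  refine ⟨isOpen_blockProd hopen, isConnected_blockProd hB_conn, hsub, fun k _ f hf => ?_⟩
  obtain ⟨v, z, hv, hz⟩ := id hT
  have hzΩ : ∀ j, z j ∈ blockProd fun r => matrixBall (E r) (Δ r) := fun j =>
    hsub ⟨v j, hv.ne_zero j, hz j⟩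
  have hdistΩ : moebiusDist (blockProd fun r => matrixBall (E r) (Δ r)) (z 1) (z 0) ≤
      √(1 - cosSq v) := by
    -- The angle between `v 0` and `v 1` is common to all blocks, so a single constant bounds every
    -- factor.
    refine moebiusDist_blockProd_le hopen (hzΩ 0) (hzΩ 1) (Real.sqrt_nonneg _) fun r => ?_
    rw [← hdist r _ (hzΩ 1 r) _ (hzΩ 0 r)]
    have hval := (hT.tupleBlock r).isTupleValue_tupleEval (Δ r)
    exact (norm_le_one_iff_norm_matrixMoebius_le (hzΩ 0 r).2 (hzΩ 1 r).2 hv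
      (hval _ _ (hv.ne_zero 0) fun i => hz 0 ⟨r, i⟩)
      (hval _ _ (hv.ne_zero 1) fun i => hz 1 ⟨r, i⟩)).1 (hnorm r)
  -- Working with `c` strictly above the supremum puts `f / c` in the open ball and covers the cases
  -- where the supremum is `0` or `∞`.
  refine le_of_forall_gt_imp_ge_of_dense fun c hc => ?_
  rcases eq_or_ne c ∞ with rfl | hctop
  · exact le_top
  have hcpos : 0 < c.toReal := ENNReal.toReal_pos (zero_le.trans_lt hc).ne' hctop
  have h := norm_tupleEval_le hv hz hzΩ hdistΩ hf hcpos fun ζ hζ => by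
    have h1 : ‖f ζ‖ₑ < c := lt_of_le_of_lt (le_iSup₂ (f := fun z _ => ‖f z‖ₑ) ζ hζ) hc
    rwa [← ofReal_norm, ENNReal.ofReal_lt_iff_lt_toReal (norm_nonneg _) hctop] at h1
  rw [← ofReal_norm]
  exact (ENNReal.ofReal_le_ofReal h).trans (ENNReal.ofReal_toReal hctop).le
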